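/- Let $G$ be a totally disconnected locally compact group, and let $\mathcal{B}(G)$ be the set of compact open subgroups of $G$ with the metric $d(V,W)=\log\bigl(|V:V\cap W|\cdot|W:W\cap V|\bigr)$. For a bicontinuous automorphism $\alpha$ of $G$, a group $O\in\mathcal{B}(G)$ is called tidy for $\alpha$ if the function $V\mapsto d(\alpha(V),V)$ on $\mathcal{B}(G)$ attains its minimum at $O$. A subgroup $H$ of $G$ is called flat if there is a single $O\in\mathcal{B}(G)$ that is tidy for the inner automorphism $x\mapsto hxh^{-1}$ for every $h\in H$. Proposition. Let $A$ be a subgroup of $G$ which is a finite extension of a finitely generated abelian group, in the sense that $A$ has a finite normal subgroup $N$ such that $A/N$ is a finitely generated abelian group. Then $A$ is a flat subgroup of $G$. -/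

import Mathlib

namespace TDLC

/-- The set `B(G)` of compact open subgroups of a topological group `G`. -/
def compactOpenSubgroups (G : Type*) [Group G] [TopologicalSpace G] : Set (Subgroup G) :=
  {V | IsCompact (V : Set G) ∧ IsOpen (V : Set G)}

/-- The distance `d(V, W) = log (|V : V ∩ W| · |W : W ∩ V|)` on compact open subgroups.
Here `(V ⊓ W).relIndex V` is the index `|V : V ∩ W|`, which is finite for compact open `V`, `W`. -/
noncomputable def subgroupDist {G : Type*} [Group G] (V W : Subgroup G) : ℝ :=
  Real.log (((V ⊓ W).relIndex V : ℝ) * ((W ⊓ V).relIndex W : ℝ))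

/-- The image `α(V)` of a subgroup under a bicontinuous automorphism. -/
def autImage {G : Type*} [Group G] [TopologicalSpace G] (α : G ≃ₜ* G) (V : Subgroup G) :
    Subgroup G :=
  V.map α.toMulEquiv.toMonoidHom

/-- The displacement function `d_α(V) = d(α(V), V)`. -/
noncomputable def displacement {G : Type*} [Group G] [TopologicalSpace G] (α : G ≃ₜ* G)
    (V : Subgroup G) : ℝ :=
  subgroupDist (autImage α V) V

/-- `O` is tidy for `α`: it is a compact open subgroup at which the displacement function of `α`
on the set of compact open subgroups attains its minimum. -/
def IsTidy {G : Type*} [Group G] [TopologicalSpace G] (O : Subgroup G) (α : G ≃ₜ* G) : Prop :=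
  O ∈ compactOpenSubgroups G ∧ IsMinOn (displacement α) (compactOpenSubgroups G) O

/-- The inner automorphism `x ↦ g * x * g⁻¹`, as a bicontinuous automorphism. -/
def innerAut {G : Type*} [Group G] [TopologicalSpace G] [IsTopologicalGroup G] (g : G) :
    G ≃ₜ* G where
  toMulEquiv := MulAut.conj g
  continuous_toFun := by
    change Continuous fun x : G => g * x * g⁻¹
    fun_prop
  continuous_invFun := by
    change Continuous fun x : G => g⁻¹ * x * g
    fun_prop

/-- A subgroup `H` of `G` is flat if some compact open subgroup of `G` is tidy for all the
inner automorphisms of `G` induced by elements of `H`. -/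
def IsFlat {G : Type*} [Group G] [TopologicalSpace G] [IsTopologicalGroup G]
    (H : Subgroup G) : Prop :=
  ∃ O ∈ compactOpenSubgroups G, ∀ h ∈ H, IsTidy O (innerAut h)

/-- `A` is a finite extension of a finitely generated abelian group: there is a short exact
sequence `1 → N → A → Q → 1` with `N` finite and `Q` finitely generated abelian. -/
def IsFiniteExtensionOfFGAbelian (A : Type*) [Group A] : Prop :=
  ∃ (N : Subgroup A) (_ : N.Normal),
    Finite N ∧ Group.FG (A ⧸ N) ∧ ∀ x y : A ⧸ N, x * y = y * x

end TDLC

/-!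
Write `[V : W]` for the index of `V ∩ W` in `V`. Since `d(h V, V)` is the logarithm of
`[h V : V] * [h⁻¹ V : V]`, it suffices to find one compact open `V` for which `[h V : V]` is
minimal, that is, equal to the scale of `h`, for all `h` in the group. All of this makes sense for a
group `Γ` acting on `G` by continuous automorphisms.

*One automorphism.* Let `V₋` and `V₊` be the subgroups of the elements of `V` whose forward,
respectively backward, `a`-orbit stays in `V`. Call `V` tidy if `V = V₊ V₋` and if every homoclinic
element (one whose orbit is in `V` at all but finitely many times) is in `V`. For tidy `V`,
`[aⁿ V : V] = [a V : V] ^ n`; since the growth of `[aⁿ V : V]` does not depend on `V` up to a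
constant, `[a V : V]` is minimal (`Tidy.relIndex_le`). The condition `V = V₊ V₋` holds after `V` is
intersected with sufficiently many of its translates (`exists_tidyAbove_orbitInf`). The second
condition then holds as soon as `V` contains the *nub* of `a` (`TidyAbove.tidy_of_nub_le`), a
compact subgroup defined without reference to `V` and normalized by all compact `a`-stable subgroups.

*Finitely many automorphisms.* Let `Φ` be a finite normal subgroup of `Γ` with `Γ ⧸ Φ` abelian. Then
`Γ` acts commutatively on the `Φ`-invariant subgroups, nubs are `Γ`-invariant, and so any finite
number of nubs normalize each other and are in a common compact open subgroup. Intersections of tidy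
subgroups being tidy (`Tidy.inf`), it can be made tidy for any finite set of elements of `Γ`
(`exists_common_tidy`).

*All automorphisms.* Let `V` be tidy for `f`, `g` and `f g`. As `V ∩ f V` is tidy for `g`, the
number `scale f * scale g / scale (f g)` is an integer (`scale_mul_dvd`). So the logarithm `ℓ` of
the scale, pulled back along a surjection `ℤᵏ → Γ ⧸ Φ`, is a subadditive and positively homogeneous
function for which `ℓ x + ℓ y - ℓ (x + y)` is either zero or at least `log 2`. By Diophantine
approximation, such a function is additive on a suitable decomposition of every `x` into elements
of a fixed finite set (`exists_splitting`). If `V` is tidy for this finite set, then `[x V : V]`,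
being submultiplicative in `x`, is at most the scale for all `x`.
-/

open Filter Topology Pointwise

namespace TDLC

/-! ### Indices and compact open subgroups -/

section Generalities

variable {G : Type*} [Group G]

/-- If every element of `K` is a product of an element of `K' ≤ K` and an element of `H`, then
`H` has the same index in `K'` and in `K`. -/
theorem relIndex_eq_of_forall_exists {H K' K : Subgroup G} (hK : K' ≤ K)
    (h : ∀ x ∈ K, ∃ y ∈ K', y⁻¹ * x ∈ H) : H.relIndex K' = H.relIndex K := by
  let f := Subgroup.quotientSubgroupOfEmbeddingOfLE H hK
  have hf : Function.Bijective f := by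
    refine ⟨?_, ?_⟩
    · exact f.injective
    · intro q
      induction q using QuotientGroup.induction_on with
      | H x =>
        obtain ⟨y, hy, hyx⟩ := h x x.2
        refine ⟨QuotientGroup.mk ⟨y, hy⟩, ?_⟩
        rw [Subgroup.quotientSubgroupOfEmbeddingOfLE_apply_mk, QuotientGroup.eq]
        simpa [Subgroup.mem_subgroupOf] using hyx
  exact Nat.card_eq_of_bijective f hf

/-- Converse of `relIndex_eq_of_forall_exists` for finite indices. -/
theorem exists_inv_mul_mem_of_relIndex_eq {H K' K : Subgroup G} (hK : K' ≤ K)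
    (h0 : H.relIndex K ≠ 0) (h : H.relIndex K' = H.relIndex K) {x : G} (hx : x ∈ K) :
    ∃ y ∈ K', y⁻¹ * x ∈ H := by
  let f := Subgroup.quotientSubgroupOfEmbeddingOfLE H hK
  have hfin : Finite (K ⧸ H.subgroupOf K) := Nat.finite_of_card_ne_zero h0
  have hfin' : Finite (K' ⧸ H.subgroupOf K') :=
    Nat.finite_of_card_ne_zero (show H.relIndex K' ≠ 0 from h ▸ h0)
  have hf : Function.Bijective f :=
    (Nat.bijective_iff_injective_and_card f).2
      ⟨f.injective, h⟩
  obtain ⟨q, hq⟩ := hf.2 (QuotientGroup.mk ⟨x, hx⟩)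
  induction q using QuotientGroup.induction_on with
  | H y =>
    refine ⟨y, y.2, ?_⟩
    rw [Subgroup.quotientSubgroupOfEmbeddingOfLE_apply_mk, QuotientGroup.eq] at hq
    simpa [Subgroup.mem_subgroupOf] using hq

/-- The triangle inequality for indices. -/
theorem relIndex_le_mul {H K L : Subgroup G} (h₁ : H.relIndex K ≠ 0) (h₂ : K.relIndex L ≠ 0) :
    H.relIndex L ≤ H.relIndex K * K.relIndex L := by
  have h₃ : H.relIndex (K ⊓ L) ≠ 0 := fun h =>
    h₁ (Subgroup.relIndex_eq_zero_of_le_right inf_le_left h)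
  have h₄ : (H ⊓ K).relIndex L ≠ 0 := by
    rw [← Subgroup.relIndex_inf_mul_relIndex]
    exact mul_ne_zero h₃ h₂
  calc H.relIndex L ≤ (H ⊓ K).relIndex L := Subgroup.relIndex_le_of_le_left inf_le_left h₄
    _ = H.relIndex (K ⊓ L) * K.relIndex L := (Subgroup.relIndex_inf_mul_relIndex _ _ _).symm
    _ ≤ _ := Nat.mul_le_mul_right _ (Subgroup.relIndex_le_of_le_right inf_le_left h₁)

variable [TopologicalSpace G] [IsTopologicalGroup G]

/-- A subset of a compact set is covered by finitely many cosets, with representatives in the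
subset, of a given open subgroup. -/
theorem exists_finite_coset_cover {V : Subgroup G} (hV : IsOpen (V : Set G)) {M S : Set G}
    (hM : IsCompact M) (hS : S ⊆ M) : ∃ T ⊆ S, T.Finite ∧ ∀ x ∈ S, ∃ t ∈ T, t⁻¹ * x ∈ V := by
  have : DiscreteTopology (G ⧸ V) := QuotientGroup.discreteTopology hV
  obtain ⟨T, hTS, hT⟩ := Set.exists_subset_bijOn S (QuotientGroup.mk : G → G ⧸ V)
  refine ⟨T, hTS, ?_, ?_⟩
  · rw [hT.finite_iff_finite]
    exact ((hM.image QuotientGroup.continuous_mk).finite_of_discrete).subset (Set.image_mono hS)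
  · intro x hx
    obtain ⟨t, ht, h⟩ := hT.2.2 ⟨x, hx, rfl⟩
    exact ⟨t, ht, QuotientGroup.eq.1 h⟩

theorem relIndex_ne_zero_of_isCompact {V K : Subgroup G} (hV : IsOpen (V : Set G))
    (hK : IsCompact (K : Set G)) : V.relIndex K ≠ 0 := by
  have : CompactSpace K := isCompact_iff_compactSpace.1 hK
  have : Finite (K ⧸ V.subgroupOf K) :=
    Subgroup.quotient_finite_of_isOpen _ (hV.preimage continuous_subtype_val)
  exact Subgroup.index_ne_zero_of_finite

/-- The conjugates of an open subgroup by the elements of a compact set have a common open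
subgroup. -/
theorem isOpen_iInf_conj {V : Subgroup G} (hV : IsOpen (V : Set G)) {M : Set G}
    (hM : IsCompact M) : IsOpen ((⨅ m ∈ M, MulAut.conj m • V : Subgroup G) : Set G) := by
  obtain ⟨T, hTM, hT, hcov⟩ := exists_finite_coset_cover hV hM subset_rfl
  have h : IsOpen ((⋂ t ∈ T, ((MulAut.conj t • V : Subgroup G) : Set G))) := by
    refine hT.isOpen_biInter fun t _ => ?_
    have : ((MulAut.conj t • V : Subgroup G) : Set G) = (fun x => t⁻¹ * x * t) ⁻¹' V := by
      ext x
      rw [SetLike.mem_coe, Subgroup.mem_pointwise_smul_iff_inv_smul_mem, MulAut.smul_def,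
        MulAut.conj_inv_apply]
      rfl
    rw [this]
    exact hV.preimage (by fun_prop)
  convert h using 1
  ext x
  simp only [Subgroup.coe_iInf, Set.mem_iInter, SetLike.mem_coe]
  refine ⟨fun hx t ht => ?_, fun hx m hm => ?_⟩
  · exact hx t (hTM ht)
  · obtain ⟨t, ht, htm⟩ := hcov m hm
    have h1 := hx t ht
    rw [Subgroup.mem_pointwise_smul_iff_inv_smul_mem] at h1 ⊢
    have h2 : (MulAut.conj m)⁻¹ • x
        = (t⁻¹ * m)⁻¹ * ((MulAut.conj t)⁻¹ • x) * (t⁻¹ * m) := by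
      simp only [MulAut.smul_def, MulAut.conj_inv_apply]
      group
    rw [h2]
    exact V.mul_mem (V.mul_mem (V.inv_mem htm) h1) htm

/-- Van Dantzig's theorem, in the weak form needed here. -/
theorem compactOpenSubgroups_nonempty [LocallyCompactSpace G] [TotallyDisconnectedSpace G] :
    (compactOpenSubgroups G).Nonempty := by
  obtain ⟨K, hK, h1K⟩ := exists_compact_mem_nhds (1 : G)
  obtain ⟨W, hW, h1W, hWK⟩ := loc_compact_Haus_tot_disc_of_zero_dim.mem_nhds_iff.1 h1K
  replace hW : IsClopen W := hW
  have hWc : IsCompact W := hK.of_isClosed_subset hW.1 hWK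
  let H : Subgroup G := MulAction.stabilizer G W
  have hHW : (H : Set G) ⊆ W := by
    intro g hg
    have h : g • W = W := hg
    rw [← h]
    exact ⟨1, h1W, by simp⟩
  have hHo : IsOpen (H : Set G) := by
    obtain ⟨U, hU, hUW⟩ := compact_open_separated_mul_left hWc hW.2 subset_rfl
    refine Subgroup.isOpen_of_mem_nhds H (g := 1) ?_
    filter_upwards [hU, inv_mem_nhds_one G hU] with g hg hg'
    have key : ∀ u ∈ U, u • W ⊆ W := by
      rintro u hu _ ⟨w, hw, rfl⟩
      exact hUW (Set.mul_mem_mul hu hw)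
    refine Set.Subset.antisymm (key g hg) ?_
    rw [Set.subset_smul_set_iff]
    exact key _ hg'
  exact ⟨H, hWc.of_isClosed_subset (Subgroup.isClosed_of_isOpen H hHo) hHW, hHo⟩

end Generalities

/-! ### Tidy subgroups and the growth of indices -/

section Dynamics

variable {Γ G : Type*} [Group Γ] [Group G] [MulDistribMulAction Γ G]

theorem pow_smul_inv_pow_add_smul (a : Γ) (k j : ℕ) (x : G) :
    a ^ k • a⁻¹ ^ (k + j) • x = a⁻¹ ^ j • x := by
  rw [pow_add, mul_smul, smul_smul, inv_pow, mul_inv_cancel, one_smul]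

theorem pow_add_smul_inv_pow_smul (a : Γ) (k j : ℕ) (x : G) :
    a ^ (k + j) • a⁻¹ ^ k • x = a ^ j • x := by
  rw [add_comm, pow_add, mul_smul, smul_smul (a ^ k), inv_pow, mul_inv_cancel, one_smul]

theorem pow_smul_inv_pow_smul (a : Γ) (k : ℕ) (x : G) : a ^ k • a⁻¹ ^ k • x = x := by
  rw [inv_pow, smul_inv_smul]

theorem inv_pow_smul_pow_smul (a : Γ) (k : ℕ) (x : G) : a⁻¹ ^ k • a ^ k • x = x := by
  rw [inv_pow, inv_smul_smul]

/-- The subgroup of the elements of `V` whose forward orbit under `a` stays in `V`. In the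
literature on tidy subgroups, `posCore a V` is `V₋` and `posCore a⁻¹ V` is `V₊`. -/
def posCore (a : Γ) (V : Subgroup G) : Subgroup G where
  carrier := {x | ∀ n : ℕ, a ^ n • x ∈ V}
  mul_mem' hx hy n := by
    rw [smul_mul']
    exact V.mul_mem (hx n) (hy n)
  one_mem' n := by
    rw [smul_one]
    exact V.one_mem
  inv_mem' hx n := by
    rw [smul_inv']
    exact V.inv_mem (hx n)

theorem mem_posCore {a : Γ} {V : Subgroup G} {x : G} :
    x ∈ posCore a V ↔ ∀ n : ℕ, a ^ n • x ∈ V := Iff.rfl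

theorem posCore_le (a : Γ) (V : Subgroup G) : posCore a V ≤ V := fun x hx => by
  simpa using hx 0

theorem posCore_mono (a : Γ) {V W : Subgroup G} (h : V ≤ W) : posCore a V ≤ posCore a W :=
  fun _ hx n => h (hx n)

theorem pow_smul_mem_posCore {a : Γ} {V : Subgroup G} {x : G} (hx : x ∈ posCore a V) (k : ℕ) :
    a ^ k • x ∈ posCore a V := fun n => by
  rw [smul_smul, ← pow_add]
  exact hx _

/-- The subgroup of the elements whose orbit under `a` is in `V` at all but finitely many times. -/
def homoclinic (a : Γ) (V : Subgroup G) : Subgroup G where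
  carrier := {x | ∀ᶠ n : ℕ in atTop, a ^ n • x ∈ V ∧ a⁻¹ ^ n • x ∈ V}
  mul_mem' hx hy := by
    filter_upwards [hx, hy] with n h1 h2
    rw [smul_mul', smul_mul']
    exact ⟨V.mul_mem h1.1 h2.1, V.mul_mem h1.2 h2.2⟩
  one_mem' := by
    refine Eventually.of_forall fun n => ?_
    rw [smul_one, smul_one]
    exact ⟨V.one_mem, V.one_mem⟩
  inv_mem' hx := by
    filter_upwards [hx] with n h
    rw [smul_inv', smul_inv']
    exact ⟨V.inv_mem h.1, V.inv_mem h.2⟩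

theorem mem_homoclinic {a : Γ} {V : Subgroup G} {x : G} :
    x ∈ homoclinic a V ↔ ∀ᶠ n : ℕ in atTop, a ^ n • x ∈ V ∧ a⁻¹ ^ n • x ∈ V := Iff.rfl

theorem homoclinic_mono (a : Γ) {V W : Subgroup G} (h : V ≤ W) :
    homoclinic a V ≤ homoclinic a W := fun _ hx => by
  filter_upwards [mem_homoclinic.1 hx] with n hn
  exact ⟨h hn.1, h hn.2⟩

theorem homoclinic_inv (a : Γ) (V : Subgroup G) : homoclinic a⁻¹ V = homoclinic a V := by
  ext x
  simp only [mem_homoclinic, inv_inv, and_comm]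

theorem smul_mem_homoclinic {a : Γ} {V : Subgroup G} {x : G} (hx : x ∈ homoclinic a V) :
    a • x ∈ homoclinic a V := by
  obtain ⟨N, hN⟩ := eventually_atTop.1 (mem_homoclinic.1 hx)
  refine mem_homoclinic.2 (eventually_atTop.2 ⟨N + 1, fun n hn => ⟨?_, ?_⟩⟩)
  · rw [smul_smul, ← pow_succ]
    exact (hN (n + 1) (by omega)).1
  · obtain ⟨m, rfl⟩ : ∃ m, n = m + 1 := ⟨n - 1, by omega⟩
    rw [pow_succ, mul_smul, inv_smul_smul]
    exact (hN m (by omega)).2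

theorem pow_smul_mem_homoclinic {a : Γ} {V : Subgroup G} {x : G} (hx : x ∈ homoclinic a V)
    (n : ℕ) : a ^ n • x ∈ homoclinic a V := by
  induction n with
  | zero => simpa using hx
  | succ n ih =>
    rw [pow_succ', mul_smul]
    exact smul_mem_homoclinic ih

theorem inv_pow_smul_mem_homoclinic {a : Γ} {V : Subgroup G} {x : G} (hx : x ∈ homoclinic a V)
    (n : ℕ) : a⁻¹ ^ n • x ∈ homoclinic a V := by
  rw [← homoclinic_inv] at hx ⊢
  exact pow_smul_mem_homoclinic hx n

/-- `V` is tidy above for `a` if `V = V₊ V₋`. -/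
def TidyAbove (a : Γ) (V : Subgroup G) : Prop :=
  ∀ x ∈ V, ∃ y ∈ posCore a⁻¹ V, ∃ z ∈ posCore a V, x = y * z

theorem TidyAbove.inv {a : Γ} {V : Subgroup G} (h : TidyAbove a V) : TidyAbove a⁻¹ V := by
  intro x hx
  obtain ⟨y, hy, z, hz, hyz⟩ := h x⁻¹ (V.inv_mem hx)
  refine ⟨z⁻¹, ?_, y⁻¹, inv_mem hy, ?_⟩
  · rw [inv_inv]
    exact inv_mem hz
  · rw [← mul_inv_rev, ← hyz, inv_inv]

/-- If `v ∈ V` has a forward iterate in `V₋`, then `v` is homoclinic up to an element of `V₋`. -/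
theorem TidyAbove.exists_mul_of_pow_smul_mem {a : Γ} {V : Subgroup G} (h : TidyAbove a V) {v : G}
    (hv : v ∈ V) {n : ℕ} (hn : a ^ n • v ∈ posCore a V) :
    ∃ y ∈ posCore a V, ∃ z ∈ homoclinic a V, v = y * z := by
  obtain ⟨y, hy, z, hz, hyz⟩ := h.inv v hv
  rw [inv_inv] at hy
  refine ⟨y, hy, z, ?_, hyz⟩
  have h1 : a ^ n • z ∈ posCore a V := by
    have : a ^ n • z = (a ^ n • y)⁻¹ * a ^ n • v := by
      rw [hyz, smul_mul', inv_mul_cancel_left]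
    rw [this]
    exact mul_mem (inv_mem (pow_smul_mem_posCore hy n)) hn
  refine mem_homoclinic.2 (eventually_atTop.2 ⟨n, fun m hm => ⟨?_, hz m⟩⟩)
  obtain ⟨k, rfl⟩ := Nat.exists_eq_add_of_le' hm
  rw [pow_add, mul_smul]
  exact h1 k

/-- `V` is tidy for `a` in the sense of Willis: `V = V₊ V₋`, and every homoclinic element of
`V` is in `V`. -/
structure Tidy (a : Γ) (V : Subgroup G) : Prop where
  above : TidyAbove a V
  below : homoclinic a V ≤ V

theorem Tidy.inv {a : Γ} {V : Subgroup G} (h : Tidy a V) : Tidy a⁻¹ V :=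
  ⟨h.above.inv, by rw [homoclinic_inv]; exact h.below⟩

/-- An orbit cannot leave a tidy subgroup and come back. -/
theorem Tidy.smul_mem {a : Γ} {V : Subgroup G} (h : Tidy a V) {x : G} (hx : x ∈ V) {n : ℕ}
    (hn : a ^ (n + 1) • x ∈ V) : a • x ∈ V := by
  obtain ⟨y, hy, z, hz, rfl⟩ := h.above.inv x hx
  rw [inv_inv] at hy
  rw [smul_mul'] at hn ⊢
  have hz1 : a ^ (n + 1) • z ∈ V := (V.mul_mem_cancel_left (hy _)).1 hn
  obtain ⟨d, hd, c, hc, hdc⟩ := h.above.inv _ hz1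
  rw [inv_inv] at hd
  have hzeq : z = a⁻¹ ^ (n + 1) • d * a⁻¹ ^ (n + 1) • c := by
    rw [← smul_mul', ← hdc, inv_pow_smul_pow_smul]
  have hc' := pow_smul_mem_posCore hc (n + 1)
  have hu : a⁻¹ ^ (n + 1) • d ∈ posCore a⁻¹ V := by
    rw [eq_mul_inv_of_mul_eq hzeq.symm]
    exact mul_mem hz (inv_mem hc')
  have hu' : a⁻¹ ^ (n + 1) • d ∈ homoclinic a V := by
    refine mem_homoclinic.2 (eventually_atTop.2 ⟨n + 1, fun m hm => ⟨?_, hu m⟩⟩)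
    obtain ⟨k, rfl⟩ := Nat.exists_eq_add_of_le hm
    rw [pow_add_smul_inv_pow_smul]
    exact hd k
  refine V.mul_mem (by simpa using hy 1) ?_
  rw [hzeq, smul_mul']
  refine V.mul_mem (h.below (smul_mem_homoclinic hu')) ?_
  rw [pow_succ', mul_smul, smul_inv_smul]
  exact hc n

/-- For tidy `V`, the inequality `|aⁿ⁺¹ V : aⁿ⁺¹ V ∩ V| ≤ |aⁿ V : aⁿ V ∩ V| |a V : a V ∩ V|`, which
holds for all compact open `V`, is an equality. -/
theorem Tidy.mul_relIndex_le_relIndex {a : Γ} {V : Subgroup G} (h : Tidy a V) (n : ℕ) :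
    V.relIndex (a ^ n • V) * V.relIndex (a • V) ≤ V.relIndex (a ^ (n + 1) • V) := by
  rcases Nat.eq_zero_or_pos n with rfl | hn0
  · simp
  obtain ⟨m, rfl⟩ : ∃ m, n = m + 1 := ⟨n - 1, by omega⟩
  have h1 : V.relIndex (a • V) = (a ^ (m + 1) • V).relIndex (a ^ (m + 1 + 1) • V) := by
    rw [pow_succ _ (m + 1), mul_smul, Subgroup.relIndex_pointwise_smul]
  have h2 : V.relIndex (a ^ (m + 1) • V ⊓ a ^ (m + 1 + 1) • V) = V.relIndex (a ^ (m + 1) • V) := by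
    refine relIndex_eq_of_forall_exists inf_le_left fun x hx => ?_
    rw [Subgroup.mem_pointwise_smul_iff_inv_smul_mem] at hx
    obtain ⟨y, hy, z, hz, hyz⟩ := h.above _ hx
    have hx' : x = a ^ (m + 1) • y * a ^ (m + 1) • z := by
      rw [← smul_mul', ← hyz, smul_inv_smul]
    refine ⟨a ^ (m + 1) • y, Subgroup.mem_inf.2 ⟨?_, ?_⟩, ?_⟩
    · rw [Subgroup.smul_mem_pointwise_smul_iff]
      exact posCore_le _ _ hy
    · rw [Subgroup.mem_pointwise_smul_iff_inv_smul_mem, ← inv_pow, pow_succ',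
        mul_smul, inv_pow_smul_pow_smul]
      simpa using hy 1
    · rw [hx', inv_mul_cancel_left]
      exact hz _
  rw [h1, ← h2, Subgroup.relIndex_inf_mul_relIndex]
  -- the orbit of an element of `V ⊓ a ^ (m + 2) • V` passes through `V` in between
  rw [← Subgroup.inf_relIndex_right (V ⊓ _), ← Subgroup.inf_relIndex_right V]
  refine le_of_eq ?_
  congr 1
  rw [inf_right_comm]
  refine inf_eq_left.2 ?_
  intro x hx
  have hx1 := (Subgroup.mem_inf.1 hx).1
  have hx2 := (Subgroup.mem_inf.1 hx).2
  rw [Subgroup.mem_pointwise_smul_iff_inv_smul_mem, ← inv_pow] at hx2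
  rw [Subgroup.mem_pointwise_smul_iff_inv_smul_mem, ← inv_pow]
  have := h.smul_mem hx2 (n := m + 1) (by rwa [pow_smul_inv_pow_smul])
  rwa [pow_succ' _ (m + 1), mul_smul, smul_inv_smul] at this

theorem Tidy.pow_relIndex_le {a : Γ} {V : Subgroup G} (h : Tidy a V) (n : ℕ) :
    V.relIndex (a • V) ^ n ≤ V.relIndex (a ^ n • V) := by
  induction n with
  | zero => simp
  | succ n ih =>
    rw [pow_succ]
    exact (Nat.mul_le_mul_right _ ih).trans (h.mul_relIndex_le_relIndex n)

end Dynamics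

section Compactness

variable {Γ G : Type*} [Group Γ] [Group G] [MulDistribMulAction Γ G]
  [TopologicalSpace G] [IsTopologicalGroup G] [ContinuousConstSMul Γ G]

theorem smul_mem_compactOpenSubgroups {Γ G : Type*} [Group Γ] [Group G] [MulDistribMulAction Γ G]
    [TopologicalSpace G] [ContinuousConstSMul Γ G] (a : Γ) {V : Subgroup G}
    (hV : V ∈ compactOpenSubgroups G) :
    a • V ∈ compactOpenSubgroups G := by
  refine ⟨?_, ?_⟩
  · rw [Subgroup.coe_pointwise_smul]
    exact hV.1.smul a
  · rw [Subgroup.coe_pointwise_smul]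
    exact hV.2.smul a

theorem inf_mem_compactOpenSubgroups {G : Type*} [Group G] [TopologicalSpace G] [T2Space G]
    {V W : Subgroup G}
    (hV : V ∈ compactOpenSubgroups G) (hW : W ∈ compactOpenSubgroups G) :
    V ⊓ W ∈ compactOpenSubgroups G :=
  ⟨hV.1.inter hW.1, hV.2.inter hW.2⟩

theorem relIndex_ne_zero {V W : Subgroup G}
    (hV : V ∈ compactOpenSubgroups G) (hW : W ∈ compactOpenSubgroups G) : V.relIndex W ≠ 0 :=
  relIndex_ne_zero_of_isCompact hV.2 hW.1

theorem relIndex_pow_smul_le (a : Γ) {W : Subgroup G} (hW : W ∈ compactOpenSubgroups G) (n : ℕ) :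
    W.relIndex (a ^ n • W) ≤ W.relIndex (a • W) ^ n := by
  induction n with
  | zero => simp
  | succ n ih =>
    calc W.relIndex (a ^ (n + 1) • W)
        ≤ W.relIndex (a ^ n • W) * (a ^ n • W).relIndex (a ^ (n + 1) • W) :=
          relIndex_le_mul (relIndex_ne_zero hW (smul_mem_compactOpenSubgroups _ hW))
            (relIndex_ne_zero (smul_mem_compactOpenSubgroups _ hW)
              (smul_mem_compactOpenSubgroups _ hW))
      _ = W.relIndex (a ^ n • W) * W.relIndex (a • W) := by
          rw [pow_succ, mul_smul, Subgroup.relIndex_pointwise_smul]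
      _ ≤ _ := by
          rw [pow_succ]
          exact Nat.mul_le_mul_right _ ih

/-- For tidy `V`, the index of `V ∩ a ^ n V` in `a ^ n V` grows as fast as possible, while up to
a constant factor its growth is the same for all compact open subgroups. Hence it is minimal. -/
theorem Tidy.pow_relIndex_le_relIndex {a : Γ} {V W : Subgroup G} (hV : V ∈ compactOpenSubgroups G)
    (h : Tidy a V) (hW : W ∈ compactOpenSubgroups G) (n : ℕ) :
    V.relIndex (a • V) ^ n ≤ W.relIndex (a ^ n • W) := by
  set s := V.relIndex (a • V)
  set t := W.relIndex (a ^ n • W)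
  have ht : 0 < t :=
    Nat.pos_of_ne_zero (relIndex_ne_zero hW (smul_mem_compactOpenSubgroups _ hW))
  have key : ∀ k : ℕ, (s ^ n) ^ k ≤ V.relIndex W * W.relIndex V * t ^ k := by
    intro k
    have e1 := relIndex_le_mul (relIndex_ne_zero hV hW)
      (relIndex_ne_zero hW (smul_mem_compactOpenSubgroups ((a ^ n) ^ k) hV))
    have e2 := relIndex_le_mul
      (relIndex_ne_zero hW (smul_mem_compactOpenSubgroups ((a ^ n) ^ k) hW))
      (relIndex_ne_zero (smul_mem_compactOpenSubgroups ((a ^ n) ^ k) hW)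
        (smul_mem_compactOpenSubgroups ((a ^ n) ^ k) hV))
    rw [Subgroup.relIndex_pointwise_smul] at e2
    calc (s ^ n) ^ k = s ^ (n * k) := (pow_mul _ _ _).symm
      _ ≤ V.relIndex (a ^ (n * k) • V) := h.pow_relIndex_le _
      _ = V.relIndex ((a ^ n) ^ k • V) := by rw [pow_mul]
      _ ≤ V.relIndex W * W.relIndex ((a ^ n) ^ k • V) := e1
      _ ≤ V.relIndex W * (W.relIndex ((a ^ n) ^ k • W) * W.relIndex V) := Nat.mul_le_mul_left _ e2
      _ ≤ V.relIndex W * (t ^ k * W.relIndex V) :=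
          Nat.mul_le_mul_left _ (Nat.mul_le_mul_right _ (relIndex_pow_smul_le (a ^ n) hW k))
      _ = _ := by ring
  -- compare the growth of the two sides of `key` in `k`
  by_contra! hlt
  have ht' : (0 : ℝ) < t := by exact_mod_cast ht
  have hr : (1 : ℝ) < (s ^ n : ℕ) / t := by
    rw [one_lt_div ht']
    exact_mod_cast hlt
  obtain ⟨k, hk⟩ := pow_unbounded_of_one_lt ((V.relIndex W * W.relIndex V : ℕ) : ℝ) hr
  rw [div_pow, lt_div_iff₀ (pow_pos ht' k)] at hk
  exact absurd (key k) (not_le.2 (by exact_mod_cast hk))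

theorem Tidy.relIndex_le {a : Γ} {V W : Subgroup G} (hV : V ∈ compactOpenSubgroups G)
    (h : Tidy a V) (hW : W ∈ compactOpenSubgroups G) :
    V.relIndex (a • V) ≤ W.relIndex (a • W) := by
  simpa using h.pow_relIndex_le_relIndex hV hW 1

end Compactness

/-! ### Tidying above, and homoclinic elements -/

section TidyingAbove

variable {Γ G : Type*} [Group Γ] [Group G] [MulDistribMulAction Γ G]

/-- The intersection of the translates `a ^ i • V` for `0 ≤ i ≤ n`. -/
def orbitInf (a : Γ) (V : Subgroup G) : ℕ → Subgroup G
  | 0 => V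
  | n + 1 => orbitInf a V n ⊓ a ^ (n + 1) • V

theorem mem_orbitInf {a : Γ} {V : Subgroup G} {n : ℕ} {x : G} :
    x ∈ orbitInf a V n ↔ ∀ i ≤ n, a⁻¹ ^ i • x ∈ V := by
  induction n with
  | zero => simp [orbitInf]
  | succ n ih =>
    rw [orbitInf, Subgroup.mem_inf, ih, Subgroup.mem_pointwise_smul_iff_inv_smul_mem, ← inv_pow]
    refine ⟨fun h i hi => ?_, fun h => ⟨fun i hi => h i (by omega), h _ le_rfl⟩⟩
    rcases Nat.lt_or_ge n i with hi' | hi'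
    · obtain rfl : i = n + 1 := by omega
      exact h.2
    · exact h.1 i hi'

theorem orbitInf_le (a : Γ) (V : Subgroup G) (n : ℕ) : orbitInf a V n ≤ V := fun x hx => by
  simpa using mem_orbitInf.1 hx 0 (Nat.zero_le n)

theorem orbitInf_induction {p : Subgroup G → Prop} (hp : ∀ V W, p V → p W → p (V ⊓ W)) {a : Γ}
    {V : Subgroup G} (h : ∀ n : ℕ, p (a ^ n • V)) (n : ℕ) : p (orbitInf a V n) := by
  induction n with
  | zero => simpa [orbitInf] using h 0
  | succ n ih => exact hp _ _ ih (h _)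

theorem orbitInf_anti (a : Γ) (V : Subgroup G) : Antitone (orbitInf a V) :=
  antitone_nat_of_succ_le fun _ => inf_le_left

theorem posCore_inv_orbitInf (a : Γ) (V : Subgroup G) (n : ℕ) :
    posCore a⁻¹ (orbitInf a V n) = posCore a⁻¹ V := by
  refine le_antisymm (posCore_mono _ (orbitInf_le a V n)) fun x hx k => mem_orbitInf.2 fun i _ => ?_
  rw [smul_smul, ← pow_add]
  exact hx _

variable [TopologicalSpace G] [ContinuousConstSMul Γ G]

theorem orbitInf_mem_compactOpenSubgroups [T2Space G] (a : Γ) {V : Subgroup G}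
    (hV : V ∈ compactOpenSubgroups G) (n : ℕ) : orbitInf a V n ∈ compactOpenSubgroups G :=
  orbitInf_induction (fun _ _ => inf_mem_compactOpenSubgroups)
    (fun _ => smul_mem_compactOpenSubgroups _ hV) n

theorem isClosed_posCore (a : Γ) {V : Subgroup G} (hV : IsClosed (V : Set G)) :
    IsClosed (posCore a V : Set G) := by
  have : (posCore a V : Set G) = ⋂ n : ℕ, (fun x => a ^ n • x) ⁻¹' V := by
    ext x
    simp [mem_posCore]
  rw [this]
  exact isClosed_iInter fun n => hV.preimage (continuous_const_smul _)

theorem isCompact_posCore [T2Space G] (a : Γ) {V : Subgroup G}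
    (hV : V ∈ compactOpenSubgroups G) : IsCompact (posCore a V : Set G) :=
  hV.1.of_isClosed_subset (isClosed_posCore a hV.1.isClosed) (posCore_le a V)

variable [IsTopologicalGroup G] [T2Space G]

/-- The indices `|a W : a W ∩ V|`, for `W` the intersection of the first `n` translates of `V`,
decrease with `n`. Where they become constant, the intersection is tidy above. -/
theorem exists_tidyAbove_orbitInf (a : Γ) {V : Subgroup G} (hV : V ∈ compactOpenSubgroups G) :
    ∃ n, TidyAbove a (orbitInf a V n) := by
  have hVcl : IsClosed (V : Set G) := hV.1.isClosed
  let f : ℕ → ℕ := fun n => V.relIndex (a • orbitInf a V n)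
  have hbox := fun n => smul_mem_compactOpenSubgroups a (orbitInf_mem_compactOpenSubgroups a hV n)
  have hf0 : ∀ n, f n ≠ 0 := fun n => relIndex_ne_zero hV (hbox n)
  have hle : ∀ {m n}, m ≤ n → a • orbitInf a V n ≤ a • orbitInf a V m := fun h =>
    Subgroup.pointwise_smul_le_pointwise_smul_iff.2 (orbitInf_anti a V h)
  obtain ⟨n₀, hn₀⟩ : ∃ n₀, ∀ n, f n₀ ≤ f n := by
    obtain ⟨_, ⟨n₀, rfl⟩, h⟩ := wellFounded_lt.has_min (Set.range f) (Set.range_nonempty f)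
    exact ⟨n₀, fun n => not_lt.1 (h _ ⟨n, rfl⟩)⟩
  set O := orbitInf a V n₀
  have hOcl : IsClosed (O : Set G) := (orbitInf_mem_compactOpenSubgroups a hV n₀).1.isClosed
  have hplus : posCore a⁻¹ V ≤ O := by
    rw [← posCore_inv_orbitInf a V n₀]
    exact posCore_le _ _
  -- stability of the index lets the first factor be chosen in `V₊`
  have hfactor : ∀ x ∈ O, ∃ y ∈ posCore a⁻¹ V, a • (y⁻¹ * x) ∈ V := by
    intro x hx
    let t : ℕ → Set G := fun k =>
      {y | y ∈ a • orbitInf a V (n₀ + k) ∧ y⁻¹ * a • x ∈ V}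
    have htcl : ∀ k, IsClosed (t k) := fun k =>
      (hbox _).1.isClosed.inter (hVcl.preimage (by fun_prop))
    obtain ⟨y, hy⟩ := IsCompact.nonempty_iInter_of_sequence_nonempty_isCompact_isClosed t
      (fun k y hy => ⟨hle (by omega) hy.1, hy.2⟩)
      (fun k => by
        have hk : n₀ ≤ n₀ + k := by omega
        have heq : f (n₀ + k) = f n₀ :=
          le_antisymm (Subgroup.relIndex_le_of_le_right (hle hk) (hf0 _)) (hn₀ _)
        obtain ⟨y, hy1, hy2⟩ := exists_inv_mul_mem_of_relIndex_eq (hle hk) (hf0 n₀) heq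
          (Subgroup.smul_mem_pointwise_smul x a O hx)
        exact ⟨y, hy1, hy2⟩)
      ((hbox _).1.of_isClosed_subset (htcl 0) fun y hy => hy.1) htcl
    rw [Set.mem_iInter] at hy
    refine ⟨a⁻¹ • y, fun n => ?_, ?_⟩
    · have h1 := (hy n).1
      rw [Subgroup.mem_pointwise_smul_iff_inv_smul_mem] at h1
      exact mem_orbitInf.1 h1 n (by omega)
    · rw [smul_mul', smul_inv', smul_inv_smul]
      exact (hy 0).2
  -- and then the second factor stays in `O` for one more step,
  have hfactorO : ∀ x ∈ O, ∃ y ∈ posCore a⁻¹ V, a • (y⁻¹ * x) ∈ O := by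
    intro x hx
    obtain ⟨y, hy, hyx⟩ := hfactor x hx
    refine ⟨y, hy, mem_orbitInf.2 fun i hi => ?_⟩
    rcases i with _ | i
    · simpa using hyx
    · rw [pow_succ, mul_smul, inv_smul_smul]
      exact mem_orbitInf.1 (O.mul_mem (O.inv_mem (hplus hy)) hx) i (by omega)
  -- and so, on iterating, for any number of steps; compactness gives all steps at once
  have hfactorN : ∀ n : ℕ, ∀ x ∈ O, ∃ y ∈ posCore a⁻¹ V, ∀ k ≤ n, a ^ k • (y⁻¹ * x) ∈ O := by
    intro n x hx
    induction n with
    | zero =>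
      refine ⟨1, one_mem _, fun k hk => ?_⟩
      obtain rfl : k = 0 := by omega
      simpa using hx
    | succ n ih =>
      obtain ⟨y, hy, hyx⟩ := ih
      obtain ⟨y', hy', hyx'⟩ := hfactorO _ (hyx n le_rfl)
      refine ⟨y * a⁻¹ ^ n • y', mul_mem hy (pow_smul_mem_posCore hy' n), fun k hk => ?_⟩
      have e : (y * a⁻¹ ^ n • y')⁻¹ * x = a⁻¹ ^ n • (y'⁻¹ * a ^ n • (y⁻¹ * x)) := by
        rw [smul_mul' (a⁻¹ ^ n) y'⁻¹, inv_pow_smul_pow_smul, smul_inv', mul_inv_rev, mul_assoc]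
      rcases Nat.lt_or_ge n k with hk' | hk'
      · obtain rfl : k = n + 1 := by omega
        rw [e, pow_succ', mul_smul, pow_smul_inv_pow_smul]
        exact hyx'
      · obtain ⟨j, rfl⟩ := Nat.exists_eq_add_of_le hk'
        rw [mul_inv_rev, mul_assoc, smul_mul', ← smul_inv', pow_smul_inv_pow_add_smul]
        exact O.mul_mem (hplus (pow_smul_mem_posCore (inv_mem hy') j)) (hyx k (by omega))
  refine ⟨n₀, fun x hx => ?_⟩
  let t : ℕ → Set G := fun n => {y | y ∈ posCore a⁻¹ V ∧ ∀ k ≤ n, a ^ k • (y⁻¹ * x) ∈ O}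
  have htcl : ∀ n, IsClosed (t n) := fun n => by
    have : t n = (posCore a⁻¹ V : Set G) ∩
        ⋂ k, ⋂ (_ : k ≤ n), (fun y => a ^ k • (y⁻¹ * x)) ⁻¹' O := by
      ext y
      simp only [t, Set.mem_ofPred_eq, Set.mem_inter_iff, Set.mem_iInter, Set.mem_preimage,
        SetLike.mem_coe]
    rw [this]
    refine (isClosed_posCore _ hVcl).inter ?_
    refine isClosed_iInter fun k => isClosed_iInter fun _ => hOcl.preimage ?_
    exact (continuous_inv.mul continuous_const).const_smul _
  obtain ⟨y, hy⟩ := IsCompact.nonempty_iInter_of_sequence_nonempty_isCompact_isClosed t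
    (fun n y hy => ⟨hy.1, fun k hk => hy.2 k (by omega)⟩)
    (fun n => hfactorN n x hx)
    ((isCompact_posCore a⁻¹ hV).of_isClosed_subset (htcl 0) fun y hy => hy.1) htcl
  rw [Set.mem_iInter] at hy
  refine ⟨y, ?_, y⁻¹ * x, fun n => (hy n).2 n le_rfl, by group⟩
  rw [posCore_inv_orbitInf]
  exact (hy 0).1

end TidyingAbove

section Bounded

variable {Γ G : Type*} [Group Γ] [Group G] [MulDistribMulAction Γ G]
  [TopologicalSpace G] [IsTopologicalGroup G]

/-- The homoclinic elements form a relatively compact set: if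
`A = 𝓛 ∩ V₊`, then `a A = T A` with `T` finite, and `T ⊆ a⁻ᵐ V₋` for some `m`. So every iterate
`aⁿ A` is in `a⁻ᵐ V₋ A`. -/
theorem exists_homoclinic_subset [ContinuousConstSMul Γ G] (a : Γ) {V : Subgroup G}
    (hV : V ∈ compactOpenSubgroups G) :
    ∃ M : Set G, IsCompact M ∧ (homoclinic a V : Set G) ⊆ M := by
  let A : Subgroup G := homoclinic a V ⊓ posCore a⁻¹ V
  have hA : ∀ x, x ∈ A ↔ x ∈ homoclinic a V ∧ x ∈ posCore a⁻¹ V := fun x => Subgroup.mem_inf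
  obtain ⟨T, hTA, hT, hcov⟩ := exists_finite_coset_cover hV.2
    (smul_mem_compactOpenSubgroups a hV).1 (S := (a • A : Subgroup G)) (by
      rw [SetLike.coe_subset_coe]
      exact Subgroup.pointwise_smul_le_pointwise_smul_iff.2 (inf_le_right.trans (posCore_le _ _)))
  have hAsmul : ∀ x ∈ (a • A : Subgroup G), x ∈ homoclinic a V ∧ a⁻¹ • x ∈ posCore a⁻¹ V := by
    intro x hx
    rw [Subgroup.mem_pointwise_smul_iff_inv_smul_mem, hA] at hx
    refine ⟨?_, hx.2⟩
    have := smul_mem_homoclinic hx.1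
    rwa [smul_inv_smul] at this
  obtain ⟨m, hm⟩ : ∃ m : ℕ, ∀ t ∈ T, ∀ n ≥ m, a ^ n • t ∈ V := by
    have : ∀ᶠ n : ℕ in atTop, ∀ t ∈ T, a ^ n • t ∈ V := by
      rw [hT.eventually_all]
      intro t ht
      filter_upwards [mem_homoclinic.1 (hAsmul t (hTA ht)).1] with n hn using hn.1
    obtain ⟨m, hm⟩ := eventually_atTop.1 this
    exact ⟨m, fun t ht n hn => hm n hn t ht⟩
  have key : ∀ n : ℕ, ∀ x ∈ A, ∃ b, (∀ k ≥ m, a ^ k • b ∈ V) ∧ ∃ c ∈ A, a ^ n • x = b * c := by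
    intro n x hx
    induction n with
    | zero => exact ⟨1, fun k _ => by rw [smul_one]; exact V.one_mem, x, hx, by simp⟩
    | succ n ih =>
      obtain ⟨b, hb, c, hc, hbc⟩ := ih
      have hac := Subgroup.smul_mem_pointwise_smul c a A hc
      obtain ⟨t, ht, htc⟩ := hcov _ hac
      refine ⟨a • b * t, fun k hk => ?_, t⁻¹ * a • c, ?_, ?_⟩
      · rw [smul_mul', smul_smul, ← pow_succ]
        exact V.mul_mem (hb _ (by omega)) (hm t ht k hk)
      · have h1 := hAsmul _ (mul_mem (inv_mem (hTA ht)) hac)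
        refine (hA _).2 ⟨h1.1, fun k => ?_⟩
        rcases k with _ | k
        · simpa using htc
        · rw [pow_succ, mul_smul]
          exact h1.2 k
      · rw [pow_succ', mul_smul, hbc, smul_mul']
        group
  refine ⟨((a⁻¹ ^ m • V : Subgroup G) : Set G) * V,
    (smul_mem_compactOpenSubgroups _ hV).1.mul hV.1, fun x hx => ?_⟩
  obtain ⟨N, hN⟩ := eventually_atTop.1 (mem_homoclinic.1 hx)
  have hxN : a⁻¹ ^ N • x ∈ A := by
    refine (hA _).2 ⟨inv_pow_smul_mem_homoclinic hx N, fun k => ?_⟩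
    rw [smul_smul, ← pow_add]
    exact (hN _ (by omega)).2
  obtain ⟨b, hb, c, hc, hbc⟩ := key N _ hxN
  rw [pow_smul_inv_pow_smul] at hbc
  rw [hbc]
  refine Set.mul_mem_mul ?_ (posCore_le _ _ ((hA c).1 hc).2)
  rw [SetLike.mem_coe, Subgroup.mem_pointwise_smul_iff_inv_smul_mem, inv_pow, inv_inv]
  exact hb m le_rfl

/-- The closure of the group of homoclinic elements. -/
def homoclinicClosure (a : Γ) (V : Subgroup G) : Subgroup G := (homoclinic a V).topologicalClosure

theorem homoclinic_le_closure (a : Γ) (V : Subgroup G) : homoclinic a V ≤ homoclinicClosure a V :=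
  Subgroup.le_topologicalClosure _

theorem isClosed_homoclinicClosure (a : Γ) (V : Subgroup G) :
    IsClosed (homoclinicClosure a V : Set G) := Subgroup.isClosed_topologicalClosure _

theorem homoclinicClosure_mono (a : Γ) {V W : Subgroup G} (h : V ≤ W) :
    homoclinicClosure a V ≤ homoclinicClosure a W :=
  Subgroup.topologicalClosure_mono (homoclinic_mono a h)

theorem homoclinicClosure_inv (a : Γ) (V : Subgroup G) :
    homoclinicClosure a⁻¹ V = homoclinicClosure a V := by
  rw [homoclinicClosure, homoclinic_inv, homoclinicClosure]

variable [ContinuousConstSMul Γ G]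

theorem pow_smul_mem_homoclinicClosure {a : Γ} {V : Subgroup G} {x : G}
    (hx : x ∈ homoclinicClosure a V) (n : ℕ) : a ^ n • x ∈ homoclinicClosure a V :=
  map_mem_closure (continuous_const_smul (a ^ n)) hx fun _ hy => pow_smul_mem_homoclinic hy n

theorem isCompact_homoclinicClosure [T2Space G] (a : Γ) {V : Subgroup G}
    (hV : V ∈ compactOpenSubgroups G) : IsCompact (homoclinicClosure a V : Set G) := by
  obtain ⟨M, hM, hle⟩ := exists_homoclinic_subset a hV
  exact hM.of_isClosed_subset (isClosed_homoclinicClosure a V) (closure_minimal hle hM.isClosed)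

variable [T2Space G]

/-- Elements of `V₋` with relatively compact backward orbit are limits of homoclinic elements: by
compactness, `a⁻ⁿ x` is in `a⁻ᵐ V₋ L` for a fixed `m` and all `n`, where `L` is the closure of the
group of homoclinic elements. Now apply `aⁿ`. -/
theorem TidyAbove.mem_homoclinicClosure {a : Γ} {V : Subgroup G} (h : TidyAbove a V)
    (hV : V ∈ compactOpenSubgroups G) {x : G} (hx : x ∈ posCore a V) {M : Set G}
    (hM : IsCompact M) (hxM : ∀ n : ℕ, a⁻¹ ^ n • x ∈ M) : x ∈ homoclinicClosure a V := by
  obtain ⟨T, hTS, hT, hcov⟩ := exists_finite_coset_cover hV.2 hM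
    (S := Set.range fun n : ℕ => a⁻¹ ^ n • x) (by rintro _ ⟨n, rfl⟩; exact hxM n)
  obtain ⟨m, hm⟩ : ∃ m : ℕ, ∀ t ∈ T, a ^ m • t ∈ posCore a V := by
    have : ∀ᶠ m : ℕ in atTop, ∀ t ∈ T, a ^ m • t ∈ posCore a V := by
      rw [hT.eventually_all]
      intro t ht
      obtain ⟨n, rfl⟩ := hTS ht
      filter_upwards [eventually_ge_atTop n] with m hmn
      obtain ⟨k, rfl⟩ := Nat.exists_eq_add_of_le hmn
      rw [pow_add_smul_inv_pow_smul]
      exact pow_smul_mem_posCore hx k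
    exact this.exists
  have key : ∀ n : ℕ, ∃ l ∈ homoclinicClosure a V, a⁻¹ ^ n • (x * l⁻¹) ∈ posCore a V := by
    intro n
    obtain ⟨t, ht, htx⟩ := hcov _ ⟨n + m, rfl⟩
    have hv : a ^ (n + m) • (t⁻¹ * a⁻¹ ^ (n + m) • x) ∈ posCore a V := by
      rw [smul_mul', pow_smul_inv_pow_smul, smul_inv', pow_add, mul_smul]
      exact mul_mem (inv_mem (pow_smul_mem_posCore (hm t ht) n)) hx
    obtain ⟨y, hy, z, hz, hyz⟩ := h.exists_mul_of_pow_smul_mem htx hv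
    refine ⟨a ^ (n + m) • z, pow_smul_mem_homoclinicClosure (homoclinic_le_closure _ _ hz) _, ?_⟩
    have e : x * (a ^ (n + m) • z)⁻¹ = a ^ (n + m) • (t * y) := by
      rw [mul_inv_eq_iff_eq_mul, ← smul_mul', mul_assoc, ← hyz, mul_inv_cancel_left,
        pow_smul_inv_pow_smul]
    rw [e, pow_add, mul_smul, inv_pow_smul_pow_smul, smul_mul']
    exact mul_mem (hm t ht) (pow_smul_mem_posCore hy m)
  let t : ℕ → Set G := fun n =>
    {l | l ∈ homoclinicClosure a V ∧ a⁻¹ ^ n • (x * l⁻¹) ∈ posCore a V}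
  have htcl : ∀ n, IsClosed (t n) := fun n =>
    (isClosed_homoclinicClosure a V).inter ((isClosed_posCore a hV.1.isClosed).preimage
      ((continuous_const.mul continuous_inv).const_smul _))
  obtain ⟨l, hl⟩ := IsCompact.nonempty_iInter_of_sequence_nonempty_isCompact_isClosed t
    (fun n l hl => ⟨hl.1, by
      have := pow_smul_mem_posCore hl.2 1
      rwa [pow_one, pow_succ', mul_smul, smul_inv_smul] at this⟩)
    (fun n => key n)
    ((isCompact_homoclinicClosure a hV).of_isClosed_subset (htcl 0) fun y hy => hy.1) htcl
  rw [Set.mem_iInter] at hl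
  have hp : x * l⁻¹ ∈ homoclinic a V := mem_homoclinic.2 <| Eventually.of_forall fun n =>
    ⟨(by simpa using (hl 0).2 : x * l⁻¹ ∈ posCore a V) n, posCore_le _ _ (hl n).2⟩
  have := mul_mem (homoclinic_le_closure _ _ hp) (hl 0).1
  rwa [inv_mul_cancel_right] at this

end Bounded

/-! ### Intersections of tidy subgroups, and the nub -/

section Intersections

variable {Γ G : Type*} [Group Γ] [Group G] [MulDistribMulAction Γ G]
  [TopologicalSpace G] [IsTopologicalGroup G] [T2Space G]

theorem Tidy.homoclinicClosure_le {a : Γ} {V : Subgroup G} (h : Tidy a V)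
    (hV : V ∈ compactOpenSubgroups G) : homoclinicClosure a V ≤ V :=
  Subgroup.topologicalClosure_minimal _ h.below hV.1.isClosed

variable [ContinuousConstSMul Γ G]

/-- The iterates of `V₋` shrink to `V₊ ∩ V₋`. -/
theorem exists_pow_smul_eq_mul (a : Γ) {V U : Subgroup G} (hV : V ∈ compactOpenSubgroups G)
    (hU : IsOpen (U : Set G)) : ∃ n : ℕ, ∀ x ∈ posCore a V,
      ∃ u ∈ U, ∃ v ∈ posCore a V ⊓ posCore a⁻¹ V, a ^ n • x = u * v := by
  let t : ℕ → Set G := fun n => (fun x => a ^ n • x) '' (posCore a V)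
  have ht : Antitone t := by
    refine antitone_nat_of_succ_le ?_
    rintro n _ ⟨x, hx, rfl⟩
    refine ⟨a ^ 1 • x, pow_smul_mem_posCore hx 1, ?_⟩
    simp only [smul_smul, ← pow_add]
  obtain ⟨n, hn⟩ := exists_subset_nhds_of_isCompact (V := t)
    (U := (U : Set G) * (posCore a V ⊓ posCore a⁻¹ V : Subgroup G)) ht.directed_ge
    (fun n => (isCompact_posCore a hV).image (continuous_const_smul _)) (by
      intro x hx
      rw [Set.mem_iInter] at hx
      refine (hU.mul_right).mem_nhds ⟨1, U.one_mem, x,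
        Subgroup.mem_inf.2 ⟨?_, fun n => ?_⟩, one_mul x⟩
      · obtain ⟨y, hy, hyx⟩ := hx 0
        simpa [← hyx] using hy
      · obtain ⟨y, hy, rfl⟩ := hx n
        simp only [inv_pow_smul_pow_smul]
        exact posCore_le _ _ hy)
  refine ⟨n, fun x hx => ?_⟩
  obtain ⟨u, hu, v, hv, h⟩ := hn ⟨x, hx, rfl⟩
  exact ⟨u, hu, v, hv, h.symm⟩

/-- An element of a tidy subgroup whose forward orbit is relatively compact never leaves it. -/
theorem Tidy.mem_posCore_of_bounded {a : Γ} {V : Subgroup G} (h : Tidy a V)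
    (hV : V ∈ compactOpenSubgroups G) {x : G} (hx : x ∈ V) {M : Set G} (hM : IsCompact M)
    (hxM : ∀ n : ℕ, a ^ n • x ∈ M) : x ∈ posCore a V := by
  obtain ⟨y, hy, z, hz, rfl⟩ := h.above x hx
  refine mul_mem ?_ hz
  have hyL : y ∈ homoclinicClosure a V := by
    rw [← homoclinicClosure_inv]
    refine h.above.inv.mem_homoclinicClosure hV hy (hM.mul hV.1) fun n => ?_
    rw [inv_inv]
    refine ⟨_, hxM n, (a ^ n • z)⁻¹, V.inv_mem (hz n), ?_⟩
    simp only [smul_mul', mul_inv_cancel_right]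
  exact fun n => h.homoclinicClosure_le hV (pow_smul_mem_homoclinicClosure hyL n)

/-- The intersection of two tidy subgroups is tidy. If `x = v₊ v₋ = w₊ w₋`, then
`w₊⁻¹ v₊ = w₋ v₋⁻¹` has a relatively compact orbit, and hence is a product of an element of
`W₊ ∩ W₋` and an element of `V₊ ∩ V₋`, by which the two factorizations can be adjusted. -/
theorem Tidy.inf {a : Γ} {V W : Subgroup G} (hV : V ∈ compactOpenSubgroups G)
    (hW : W ∈ compactOpenSubgroups G) (h : Tidy a V) (h' : Tidy a W) : Tidy a (V ⊓ W) := by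
  refine ⟨fun x hx => ?_, fun x hx => Subgroup.mem_inf.2
    ⟨h.below (homoclinic_mono a inf_le_left hx), h'.below (homoclinic_mono a inf_le_right hx)⟩⟩
  obtain ⟨hxV, hxW⟩ := Subgroup.mem_inf.1 hx
  obtain ⟨v, hv, v', hv', hvx⟩ := h.above x hxV
  obtain ⟨w, hw, w', hw', hwx⟩ := h'.above x hxW
  have hz : w⁻¹ * v = w' * v'⁻¹ := by
    rw [inv_mul_eq_iff_eq_mul, ← mul_assoc, ← hwx, hvx, mul_inv_cancel_right]
  obtain ⟨n, hn⟩ := exists_pow_smul_eq_mul a hV hW.2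
  obtain ⟨u, hu, c, hc, huc⟩ := hn v'⁻¹ (inv_mem hv')
  obtain ⟨hc1, hc2⟩ := Subgroup.mem_inf.1 hc
  -- `b` is the component in `W` of the `n`-th iterate of `w⁻¹ * v`
  set b := a ^ n • w' * u with hb
  have hbW : b ∈ W := W.mul_mem (hw' n) hu
  have hbz : b = a ^ n • (w⁻¹ * v) * c⁻¹ := by
    rw [hz, smul_mul', huc, hb]
    group
  have hfwd : b ∈ posCore a W := by
    refine h'.mem_posCore_of_bounded hW hbW (hW.1.mul (hV.1.mul hV.1)) fun k => ?_
    rw [hbz, hz, smul_mul', smul_mul', smul_mul', smul_smul, smul_smul, ← pow_add, mul_assoc]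
    exact Set.mul_mem_mul (hw' _) (Set.mul_mem_mul (inv_mem hv' _) (inv_mem hc1 _))
  have hbwd : b ∈ posCore a⁻¹ W := by
    refine h'.inv.mem_posCore_of_bounded hW hbW
      (((hW.1.mul hV.1).smul (a ^ n)).mul hV.1) fun k => ?_
    have e : a⁻¹ ^ k • b = a ^ n • (a⁻¹ ^ k • w⁻¹ * a⁻¹ ^ k • v) * a⁻¹ ^ k • c⁻¹ := by
      rw [hbz, smul_mul' (a⁻¹ ^ k), smul_smul, ((Commute.refl a).inv_left.pow_pow k n).eq,
        mul_smul, smul_mul' (a⁻¹ ^ k) w⁻¹]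
    rw [e]
    exact Set.mul_mem_mul (Set.smul_mem_smul_set (Set.mul_mem_mul (inv_mem hw _) (hv _)))
      (inv_mem hc2 _)
  have key : w⁻¹ * v = a⁻¹ ^ n • b * a⁻¹ ^ n • c := by
    rw [← smul_mul', hbz, inv_mul_cancel_right, inv_pow_smul_pow_smul]
  have hb0 : a⁻¹ ^ n • b ∈ posCore a W := by
    intro k
    rcases le_total k n with hk | hk
    · obtain ⟨j, rfl⟩ := Nat.exists_eq_add_of_le hk
      rw [pow_smul_inv_pow_add_smul]
      exact hbwd _
    · obtain ⟨j, rfl⟩ := Nat.exists_eq_add_of_le hk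
      rw [pow_add_smul_inv_pow_smul]
      exact hfwd _
  have hc0 : a⁻¹ ^ n • c ∈ posCore a V := by
    intro k
    rcases le_total k n with hk | hk
    · obtain ⟨j, rfl⟩ := Nat.exists_eq_add_of_le hk
      rw [pow_smul_inv_pow_add_smul]
      exact hc2 _
    · obtain ⟨j, rfl⟩ := Nat.exists_eq_add_of_le hk
      rw [pow_add_smul_inv_pow_smul]
      exact hc1 _
  have hb1 := pow_smul_mem_posCore hbwd n
  have hc1 := pow_smul_mem_posCore hc2 n
  have hp : v * (a⁻¹ ^ n • c)⁻¹ = w * a⁻¹ ^ n • b := by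
    rw [mul_inv_eq_iff_eq_mul, mul_assoc, ← key, mul_inv_cancel_left]
  have hq : a⁻¹ ^ n • c * v' = (a⁻¹ ^ n • b)⁻¹ * w' := by
    rw [eq_inv_mul_iff_mul_eq, ← mul_assoc, ← key, hz, inv_mul_cancel_right]
  refine ⟨v * (a⁻¹ ^ n • c)⁻¹, fun k => Subgroup.mem_inf.2 ⟨?_, ?_⟩, a⁻¹ ^ n • c * v',
    fun k => Subgroup.mem_inf.2 ⟨?_, ?_⟩, ?_⟩
  · exact mul_mem hv (inv_mem hc1) k
  · rw [hp]
    exact mul_mem hw hb1 k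
  · exact mul_mem hc0 hv' k
  · rw [hq]
    exact mul_mem (inv_mem hb0) hw' k
  · rw [hvx]
    group

end Intersections

section Nub

variable {Γ G : Type*} [Group Γ] [Group G] [MulDistribMulAction Γ G]
  [TopologicalSpace G] [IsTopologicalGroup G]

/-- The nub of `a`: the intersection, over all compact open subgroups `W`, of the closures of the
groups of elements homoclinic with respect to `W`. -/
def nub (a : Γ) : Subgroup G := ⨅ W ∈ compactOpenSubgroups G, homoclinicClosure a W

theorem mem_nub {a : Γ} {x : G} :
    x ∈ (nub a : Subgroup G) ↔ ∀ W ∈ compactOpenSubgroups G, x ∈ homoclinicClosure a W := by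
  simp only [nub, Subgroup.mem_iInf]

theorem nub_le {a : Γ} {W : Subgroup G} (hW : W ∈ compactOpenSubgroups G) :
    nub a ≤ homoclinicClosure a W := fun _ hx => mem_nub.1 hx W hW

theorem isCompact_nub [T2Space G] [ContinuousConstSMul Γ G]
    (hne : (compactOpenSubgroups G).Nonempty) (a : Γ) :
    IsCompact ((nub a : Subgroup G) : Set G) := by
  obtain ⟨W, hW⟩ := hne
  refine (isCompact_homoclinicClosure a hW).of_isClosed_subset ?_ (nub_le hW)
  simp only [nub, Subgroup.coe_iInf]
  exact isClosed_biInter fun W _ => isClosed_homoclinicClosure a W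

/-- The nub of `a` is normalized by every compact `a`-stable subgroup. -/
theorem conj_mem_nub {a : Γ} {K : Subgroup G} (hK : IsCompact (K : Set G)) (haK : a • K = K)
    {k x : G} (hk : k ∈ K) (hx : x ∈ (nub a : Subgroup G)) :
    k * x * k⁻¹ ∈ (nub a : Subgroup G) := by
  have hpow : ∀ (b : Γ), b • K = K → ∀ n : ℕ, ∀ y ∈ K, b ^ n • y ∈ K := by
    intro b hb n y hy
    induction n with
    | zero => simpa using hy
    | succ n ih =>
      rw [pow_succ', mul_smul, ← hb]
      exact Subgroup.smul_mem_pointwise_smul _ _ _ ih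
  have haK' : a⁻¹ • K = K := by rw [inv_smul_eq_iff, haK]
  rw [mem_nub] at hx ⊢
  intro W hW
  let U : Subgroup G := (⨅ m ∈ (K : Set G), MulAut.conj m • W) ⊓ W
  have hUo : IsOpen (U : Set G) := (isOpen_iInf_conj hW.2 hK).inter hW.2
  have hU : U ∈ compactOpenSubgroups G :=
    ⟨hW.1.of_isClosed_subset (U.isClosed_of_isOpen hUo) fun y hy => (Subgroup.mem_inf.1 hy).2, hUo⟩
  have hconj : ∀ m ∈ K, ∀ y ∈ U, m * y * m⁻¹ ∈ W := by
    intro m hm y hy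
    have h1 := (Subgroup.mem_inf.1 hy).1
    simp only [Subgroup.mem_iInf] at h1
    have h2 := h1 m⁻¹ (K.inv_mem hm)
    rwa [Subgroup.mem_pointwise_smul_iff_inv_smul_mem, map_inv, inv_inv, MulAut.smul_def,
      MulAut.conj_apply] at h2
  refine map_mem_closure (f := fun y => k * y * k⁻¹) (by fun_prop) (hx U hU) fun y hy => ?_
  refine mem_homoclinic.2 ?_
  filter_upwards [mem_homoclinic.1 hy] with n hn
  simp only [smul_mul', smul_inv']
  exact ⟨hconj _ (hpow a haK n k hk) _ hn.1, hconj _ (hpow _ haK' n k hk) _ hn.2⟩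

variable [T2Space G] [ContinuousConstSMul Γ G]

/-- A tidy above subgroup that contains the nub is tidy: by compactness it contains the closure `L`
of the group of homoclinic elements of some smaller tidy above subgroup `W`, and
`V₋ ⊆ W₋₋ L (V₊ ∩ V₋)`, where `W₋₋` is the union of the backward
iterates of `W₋`. -/
theorem TidyAbove.tidy_of_nub_le {a : Γ} {V : Subgroup G} (h : TidyAbove a V)
    (hV : V ∈ compactOpenSubgroups G) (hnub : nub a ≤ V) : Tidy a V := by
  refine ⟨h, fun x hx => ?_⟩
  obtain ⟨W, hW, hWa, hWV, hWL⟩ : ∃ W ∈ compactOpenSubgroups G, TidyAbove a W ∧ W ≤ V ∧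
      homoclinicClosure a W ≤ V := by
    have : Nonempty (compactOpenSubgroups G) := ⟨⟨V, hV⟩⟩
    obtain ⟨⟨W₁, hW₁⟩, hle⟩ := exists_subset_nhds_of_isCompact
      (V := fun W : compactOpenSubgroups G => (homoclinicClosure a (W : Subgroup G) : Set G))
      (U := V) (by
        rintro ⟨W₁, hW₁⟩ ⟨W₂, hW₂⟩
        exact ⟨⟨W₁ ⊓ W₂, inf_mem_compactOpenSubgroups hW₁ hW₂⟩,
          homoclinicClosure_mono a inf_le_left, homoclinicClosure_mono a inf_le_right⟩)
      (fun W => isCompact_homoclinicClosure a W.2) (by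
        intro y hy
        refine hV.2.mem_nhds (hnub (mem_nub.2 fun W hW => ?_))
        exact Set.mem_iInter.1 hy ⟨W, hW⟩)
    have hWV := inf_mem_compactOpenSubgroups hW₁ hV
    obtain ⟨n, hn⟩ := exists_tidyAbove_orbitInf a hWV
    exact ⟨_, orbitInf_mem_compactOpenSubgroups a hWV n, hn,
      (orbitInf_le _ _ _).trans inf_le_right,
      (homoclinicClosure_mono a ((orbitInf_le _ _ _).trans inf_le_left)).trans hle⟩
  have hL : ∀ y ∈ homoclinicClosure a W, ∀ n : ℕ, a⁻¹ ^ n • y ∈ homoclinicClosure a W := by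
    intro y hy n
    rw [← homoclinicClosure_inv] at hy ⊢
    exact pow_smul_mem_homoclinicClosure hy n
  obtain ⟨N, hN⟩ := eventually_atTop.1 (mem_homoclinic.1 hx)
  have hxN : a ^ N • x ∈ posCore a V := fun k => by
    rw [smul_smul, ← pow_add]
    exact (hN _ (by omega)).1
  obtain ⟨n, hn⟩ := exists_pow_smul_eq_mul a hV hW.2
  obtain ⟨w, hw, v, hv, hwv⟩ := hn _ hxN
  obtain ⟨hv1, hv2⟩ := Subgroup.mem_inf.1 hv
  obtain ⟨y, hy, z, hz, rfl⟩ := hWa.inv w hw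
  rw [inv_inv] at hy
  have hx2 := pow_smul_mem_posCore hxN n
  set x' := a ^ n • a ^ N • x with hx'
  have hx'L : ∀ k : ℕ, a⁻¹ ^ k • x' ∈ homoclinicClosure a V := fun k =>
    homoclinic_le_closure _ _ (inv_pow_smul_mem_homoclinic
      (pow_smul_mem_homoclinic (pow_smul_mem_homoclinic hx N) n) k)
  have hzL : z ∈ homoclinicClosure a W := by
    rw [← homoclinicClosure_inv]
    refine hWa.inv.mem_homoclinicClosure hW hz hV.1 fun k => ?_
    rw [inv_inv]
    have e : z = y⁻¹ * x' * v⁻¹ := by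
      rw [hwv]
      group
    rw [e]
    exact mul_mem (mul_mem (inv_mem (posCore_mono a hWV hy)) hx2) (inv_mem hv1) k
  have hyL : y ∈ homoclinicClosure a W := by
    refine hWa.mem_homoclinicClosure hW hy
      ((isCompact_homoclinicClosure a hV).mul hV.1) fun k => ?_
    have e : y = x' * (z * v)⁻¹ := by
      rw [hwv]
      group
    rw [e, smul_mul', smul_inv', smul_mul']
    exact Set.mul_mem_mul (hx'L k) (V.inv_mem (V.mul_mem (hWL (hL z hzL k)) (hv2 k)))
  have e : x = a⁻¹ ^ (N + n) • (y * z * v) := by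
    rw [← hwv, hx', smul_smul (a ^ n), ← pow_add, Nat.add_comm n N, inv_pow_smul_pow_smul]
  rw [e, smul_mul']
  exact V.mul_mem (hWL (hL _ (mul_mem hyL hzL) _)) (hv2 _)

end Nub

/-! ### Common tidy subgroups -/

section CommutingTranslates

variable {Γ G : Type*} [Group Γ] [Group G] [MulDistribMulAction Γ G]

/-- `Γ` acts commutatively on the translates of `V`. -/
def CommutingTranslates (Γ : Type*) {G : Type*} [Group Γ] [Group G] [MulDistribMulAction Γ G]
    (V : Subgroup G) : Prop :=
  ∀ g h : Γ, g • h • V = h • g • V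

theorem CommutingTranslates.smul {V : Subgroup G} (hV : CommutingTranslates Γ V) (k : Γ) :
    CommutingTranslates Γ (k • V) := fun g h => by
  rw [smul_smul h k, hV g, mul_smul, hV k g]

theorem CommutingTranslates.inf {V W : Subgroup G} (hV : CommutingTranslates Γ V)
    (hW : CommutingTranslates Γ W) : CommutingTranslates Γ (V ⊓ W) := fun g h => by
  rw [Subgroup.smul_inf, Subgroup.smul_inf, Subgroup.smul_inf, Subgroup.smul_inf, hV, hW]

theorem CommutingTranslates.smul_mem_smul_iff {V : Subgroup G} (hV : CommutingTranslates Γ V)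
    (g h : Γ) (x : G) : h • x ∈ g • V ↔ h • g⁻¹ • x ∈ V := by
  rw [← Subgroup.mem_inv_pointwise_smul_iff, ← Subgroup.mem_inv_pointwise_smul_iff, hV,
    Subgroup.mem_pointwise_smul_iff_inv_smul_mem]

theorem CommutingTranslates.mem_posCore_smul {V : Subgroup G} (hV : CommutingTranslates Γ V)
    (a g : Γ) (x : G) : x ∈ posCore a (g • V) ↔ g⁻¹ • x ∈ posCore a V := by
  simp only [mem_posCore, hV.smul_mem_smul_iff]

theorem CommutingTranslates.mem_homoclinic_smul {V : Subgroup G} (hV : CommutingTranslates Γ V)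
    (a g : Γ) (x : G) : x ∈ homoclinic a (g • V) ↔ g⁻¹ • x ∈ homoclinic a V := by
  simp only [mem_homoclinic, hV.smul_mem_smul_iff]

theorem Tidy.smul {a : Γ} {V : Subgroup G} (h : Tidy a V) (hV : CommutingTranslates Γ V)
    (g : Γ) : Tidy a (g • V) := by
  refine ⟨fun x hx => ?_, fun x hx => ?_⟩
  · obtain ⟨y, hy, z, hz, hyz⟩ := h.above _ (Subgroup.mem_pointwise_smul_iff_inv_smul_mem.1 hx)
    refine ⟨g • y, ?_, g • z, ?_, ?_⟩
    · rwa [hV.mem_posCore_smul, inv_smul_smul]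
    · rwa [hV.mem_posCore_smul, inv_smul_smul]
    · rw [← smul_mul', ← hyz, smul_inv_smul]
  · rw [hV.mem_homoclinic_smul] at hx
    exact Subgroup.mem_pointwise_smul_iff_inv_smul_mem.2 (h.below hx)

variable [TopologicalSpace G] [T2Space G] [ContinuousConstSMul Γ G]

/-- If the commutators of `Γ` are in a finite subgroup `Φ`, then the intersection of the
`Φ`-translates of a compact open subgroup has commuting translates. -/
theorem exists_commutingTranslates {Φ : Subgroup Γ} [Finite Φ]
    (hΦ : ∀ g h : Γ, (h * g)⁻¹ * (g * h) ∈ Φ) {V : Subgroup G} (hV : V ∈ compactOpenSubgroups G) :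
    ∃ W ∈ compactOpenSubgroups G, CommutingTranslates Γ W ∧ W ≤ V ∧
      ∀ K : Subgroup G, (∀ g : Γ, g • K = K) → K ≤ V → K ≤ W := by
  let W : Subgroup G := ⨅ φ : Φ, (φ : Γ) • V
  have hmem : ∀ x, x ∈ W ↔ ∀ φ ∈ Φ, φ⁻¹ • x ∈ V := fun x => by
    simp only [W, Subgroup.mem_iInf, Subgroup.mem_pointwise_smul_iff_inv_smul_mem, Subtype.forall]
  have hWV : W ≤ V := fun x hx => by simpa using (hmem x).1 hx 1 Φ.one_mem
  have hWΦ : ∀ φ ∈ Φ, φ • W = W := by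
    intro φ hφ
    ext x
    rw [Subgroup.mem_pointwise_smul_iff_inv_smul_mem, hmem, hmem]
    refine ⟨fun h ψ hψ => ?_, fun h ψ hψ => ?_⟩
    · have := h (φ⁻¹ * ψ) (Φ.mul_mem (Φ.inv_mem hφ) hψ)
      rwa [smul_smul, mul_inv_rev, inv_inv, mul_assoc, mul_inv_cancel, mul_one] at this
    · rw [smul_smul, ← mul_inv_rev]
      exact h _ (Φ.mul_mem hφ hψ)
  have hWo : IsOpen (W : Set G) := by
    simp only [W, Subgroup.coe_iInf]
    exact isOpen_iInter_of_finite fun φ => (smul_mem_compactOpenSubgroups (φ : Γ) hV).2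
  have hWc : IsClosed (W : Set G) := by
    simp only [W, Subgroup.coe_iInf]
    exact isClosed_iInter fun φ => (smul_mem_compactOpenSubgroups (φ : Γ) hV).1.isClosed
  refine ⟨W, ⟨hV.1.of_isClosed_subset hWc hWV, hWo⟩, fun g h => ?_, hWV, fun K hK hKV x hx => ?_⟩
  · rw [smul_smul, smul_smul, show g * h = h * g * ((h * g)⁻¹ * (g * h)) by group, mul_smul,
      hWΦ _ (hΦ g h)]
  · rw [hmem]
    intro φ _
    refine hKV ?_
    rw [← hK φ⁻¹]
    exact Subgroup.smul_mem_pointwise_smul _ _ _ hx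

variable [IsTopologicalGroup G]

/-- Nubs are `Γ`-stable, as they may be computed from subgroups with commuting translates. -/
theorem smul_nub {Φ : Subgroup Γ} [Finite Φ] (hΦ : ∀ g h : Γ, (h * g)⁻¹ * (g * h) ∈ Φ)
    (g a : Γ) : g • (nub a : Subgroup G) = nub a := by
  have key : ∀ g : Γ, g • (nub a : Subgroup G) ≤ nub a := by
    intro g x hx
    rw [Subgroup.mem_pointwise_smul_iff_inv_smul_mem] at hx
    rw [mem_nub]
    intro W hW
    obtain ⟨U, hU, hUc, hUW, -⟩ := exists_commutingTranslates hΦ hW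
    have h1 := mem_nub.1 hx _ (smul_mem_compactOpenSubgroups g⁻¹ hU)
    rw [← smul_inv_smul g x]
    refine homoclinicClosure_mono a hUW (map_mem_closure (continuous_const_smul g) h1 ?_)
    intro y hy
    rwa [SetLike.mem_coe, hUc.mem_homoclinic_smul, inv_inv] at hy
  refine le_antisymm (key g) ?_
  rw [Subgroup.subset_pointwise_smul_iff]
  exact key g⁻¹

/-- Finitely many nubs are contained in a common compact open subgroup, since each of them is
compact and they normalize each other. -/
theorem exists_nub_le (hne : (compactOpenSubgroups G).Nonempty) {Φ : Subgroup Γ} [Finite Φ]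
    (hΦ : ∀ g h : Γ, (h * g)⁻¹ * (g * h) ∈ Φ) (S : Finset Γ) :
    ∃ W ∈ compactOpenSubgroups G, ∀ a ∈ S, nub a ≤ W := by
  classical
  induction S using Finset.induction_on with
  | empty =>
    obtain ⟨W, hW⟩ := hne
    exact ⟨W, hW, by simp⟩
  | insert a S _ ih =>
    obtain ⟨W, hW, hSW⟩ := ih
    let K : Subgroup G := nub a
    have hKc : IsCompact (K : Set G) := isCompact_nub hne a
    let C : Subgroup G := ⨅ m ∈ (K : Set G), MulAut.conj m • W
    have hmem : ∀ x, x ∈ C ↔ ∀ m ∈ K, m⁻¹ * x * m ∈ W := fun x => by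
      simp only [C, Subgroup.mem_iInf, Subgroup.mem_pointwise_smul_iff_inv_smul_mem,
        MulAut.smul_def, MulAut.conj_inv_apply, SetLike.mem_coe]
    have hCW : C ≤ W := fun x hx => by simpa using (hmem x).1 hx 1 K.one_mem
    have hCo : IsOpen (C : Set G) := isOpen_iInf_conj hW.2 hKc
    have hnorm : K ≤ Subgroup.normalizer (C : Set G) := by
      intro k hk
      rw [Subgroup.mem_normalizer_iff]
      intro x
      rw [hmem, hmem]
      refine ⟨fun h m hm => ?_, fun h m hm => ?_⟩
      · have := h (k⁻¹ * m) (K.mul_mem (K.inv_mem hk) hm)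
        convert this using 1
        group
      · have := h (k * m) (K.mul_mem hk hm)
        convert this using 1
        group
    have hcoe := Subgroup.coe_mul_of_left_le_normalizer_right K C hnorm
    refine ⟨K ⊔ C, ⟨?_, Subgroup.isOpen_mono le_sup_right hCo⟩, fun b hb => ?_⟩
    · rw [hcoe]
      exact hKc.mul (hW.1.of_isClosed_subset (C.isClosed_of_isOpen hCo) hCW)
    · rcases Finset.mem_insert.1 hb with rfl | hb
      · exact le_sup_left
      · refine le_trans (fun x hx => (hmem x).2 fun m hm => hSW b hb ?_) le_sup_right
        have := conj_mem_nub hKc (smul_nub hΦ b a) (K.inv_mem hm) hx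
        rwa [inv_inv] at this

/-- Finitely many elements of `Γ` have a common tidy subgroup: once a compact open subgroup
contains their nubs, it remains to make it tidy above for one element after the other. -/
theorem exists_common_tidy (hne : (compactOpenSubgroups G).Nonempty) {Φ : Subgroup Γ} [Finite Φ]
    (hΦ : ∀ g h : Γ, (h * g)⁻¹ * (g * h) ∈ Φ) (S : Finset Γ) :
    ∃ V ∈ compactOpenSubgroups G, CommutingTranslates Γ V ∧ ∀ a ∈ S, Tidy a V := by
  classical
  suffices h : ∀ T : Finset Γ, T ⊆ S → ∃ V ∈ compactOpenSubgroups G, CommutingTranslates Γ V ∧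
      (∀ a ∈ S, nub a ≤ V) ∧ ∀ a ∈ T, Tidy a V by
    obtain ⟨V, hV, hVc, -, hVt⟩ := h S subset_rfl
    exact ⟨V, hV, hVc, hVt⟩
  intro T hT
  induction T using Finset.induction_on with
  | empty =>
    obtain ⟨W, hW, hWn⟩ := exists_nub_le hne hΦ S
    obtain ⟨V, hV, hVc, -, hVn⟩ := exists_commutingTranslates hΦ hW
    exact ⟨V, hV, hVc, fun a ha => hVn _ (fun g => smul_nub hΦ g a) (hWn a ha), by simp⟩
  | insert a T _ ih =>
    obtain ⟨V, hV, hVc, hVn, hVt⟩ := ih ((Finset.subset_insert a T).trans hT)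
    obtain ⟨n, hn⟩ := exists_tidyAbove_orbitInf a hV
    have hO := orbitInf_mem_compactOpenSubgroups a hV n
    have hOn : ∀ b ∈ S, nub b ≤ orbitInf a V n := fun b hb =>
      orbitInf_induction (p := fun W => nub b ≤ W) (fun _ _ => le_inf) (fun k => by
        rw [← smul_nub hΦ (a ^ k) b]
        exact Subgroup.pointwise_smul_le_pointwise_smul_iff.2 (hVn b hb)) n
    refine ⟨_, hO, orbitInf_induction (fun _ _ => CommutingTranslates.inf) (fun k => hVc.smul _) n,
      hOn, fun b hb => ?_⟩
    rcases Finset.mem_insert.1 hb with rfl | hb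
    · exact hn.tidy_of_nub_le hO (hOn b (hT (Finset.mem_insert_self _ _)))
    · exact (orbitInf_induction (p := fun W => W ∈ compactOpenSubgroups G ∧ Tidy b W)
        (fun _ _ h1 h2 => ⟨inf_mem_compactOpenSubgroups h1.1 h2.1, h1.2.inf h1.1 h2.1 h2.2⟩)
        (fun k => ⟨smul_mem_compactOpenSubgroups _ hV, (hVt b hb).smul hVc _⟩) n).2

end CommutingTranslates

/-! ### The scale -/

section Scale

variable {Γ G : Type*} [Group Γ] [Group G] [MulDistribMulAction Γ G] [TopologicalSpace G]

/-- The scale of `a`: the least index of `V ∩ a V` in `a V`, for compact open subgroups `V`. -/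
noncomputable def scale (G : Type*) {Γ : Type*} [Group Γ] [Group G] [MulDistribMulAction Γ G]
    [TopologicalSpace G] (a : Γ) : ℕ :=
  sInf ((fun V : Subgroup G => V.relIndex (a • V)) '' compactOpenSubgroups G)

theorem scale_le (a : Γ) {V : Subgroup G} (hV : V ∈ compactOpenSubgroups G) :
    scale G a ≤ V.relIndex (a • V) := Nat.sInf_le ⟨V, hV, rfl⟩

theorem exists_scale_eq (hne : (compactOpenSubgroups G).Nonempty) (a : Γ) :
    ∃ V ∈ compactOpenSubgroups G, V.relIndex (a • V) = scale G a :=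
  Nat.sInf_mem (hne.image _)

variable [IsTopologicalGroup G] [ContinuousConstSMul Γ G]

theorem scale_pos (hne : (compactOpenSubgroups G).Nonempty) (a : Γ) : 0 < scale G a := by
  obtain ⟨V, hV, h⟩ := exists_scale_eq hne a
  rw [← h]
  exact Nat.pos_of_ne_zero (relIndex_ne_zero hV (smul_mem_compactOpenSubgroups a hV))

theorem Tidy.relIndex_eq_scale {a : Γ} {V : Subgroup G} (h : Tidy a V)
    (hV : V ∈ compactOpenSubgroups G) : V.relIndex (a • V) = scale G a := by
  refine le_antisymm ?_ (scale_le a hV)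
  obtain ⟨W, hW, hWs⟩ := exists_scale_eq ⟨V, hV⟩ a
  rw [← hWs]
  exact h.relIndex_le hV hW

theorem Tidy.scale_pow_le {a : Γ} {V : Subgroup G} (h : Tidy a V)
    (hV : V ∈ compactOpenSubgroups G) (n : ℕ) : scale G a ^ n ≤ scale G (a ^ n) := by
  obtain ⟨W, hW, hWs⟩ := exists_scale_eq ⟨V, hV⟩ (a ^ n)
  rw [← hWs, ← h.relIndex_eq_scale hV]
  exact h.pow_relIndex_le_relIndex hV hW n

theorem relIndex_mul_smul_le {V : Subgroup G} (hV : V ∈ compactOpenSubgroups G) (f g : Γ) :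
    V.relIndex ((f * g) • V) ≤ V.relIndex (f • V) * V.relIndex (g • V) := by
  have := relIndex_le_mul (relIndex_ne_zero hV (smul_mem_compactOpenSubgroups f hV))
    (relIndex_ne_zero (smul_mem_compactOpenSubgroups f hV)
      (smul_mem_compactOpenSubgroups (f * g) hV))
  rw [mul_smul, Subgroup.relIndex_pointwise_smul] at this
  rwa [mul_smul]

/-- If `V` is tidy for `f`, `g` and `f * g`, then `scale (f * g)` divides `scale f * scale g`. The
reason is that `U = V ∩ f V` is tidy for `g`, so that `scale g = |g U : g U ∩ U|` is a multiple of
`|V₂ ∩ V₁ : V₂ ∩ V₁ ∩ V₀|` for `V₀ = V`, `V₁ = g V`, `V₂ = f g V`. -/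
theorem scale_mul_dvd [T2Space G] {f g : Γ} {V : Subgroup G} (hV : V ∈ compactOpenSubgroups G)
    (hc : CommutingTranslates Γ V) (hf : Tidy f V) (hg : Tidy g V) (hfg : Tidy (f * g) V) :
    scale G (f * g) ∣ scale G f * scale G g := by
  have hfV := smul_mem_compactOpenSubgroups f hV
  have hgU : (V ⊓ f • V).relIndex (g • (V ⊓ f • V)) = scale G g :=
    (hg.inf hV hfV (hg.smul hc f)).relIndex_eq_scale (inf_mem_compactOpenSubgroups hV hfV)
  rw [Subgroup.smul_inf, hc g f, ← mul_smul, inf_comm V, ← Subgroup.relIndex_inf_mul_relIndex]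
    at hgU
  have h1 : (g • V).relIndex ((f * g) • V) = scale G f := by
    rw [mul_smul, hc f g, Subgroup.relIndex_pointwise_smul, hf.relIndex_eq_scale hV]
  have h2 : V.relIndex (g • V ⊓ (f * g) • V) ∣ scale G g := ⟨_, by rw [← hgU, mul_comm]⟩
  rw [← hfg.relIndex_eq_scale hV]
  calc V.relIndex ((f * g) • V) ∣ (V ⊓ g • V).relIndex ((f * g) • V) :=
        Subgroup.relIndex_dvd_of_le_left _ inf_le_left
    _ = V.relIndex (g • V ⊓ (f * g) • V) * scale G f := by
        rw [← h1, Subgroup.relIndex_inf_mul_relIndex]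
    _ ∣ scale G g * scale G f := Nat.mul_dvd_mul_right h2 _
    _ = _ := mul_comm _ _

end Scale

/-! ### Subadditive functions on lattices with a gap -/

section Lattice

/-- Simultaneous Diophantine approximation: some multiple `t w` with `1 ≤ t ≤ Q ^ k` is within
`1 / Q` of an integer vector. -/
theorem exists_int_vector_near_mul {k : ℕ} (w : Fin k → ℝ) {Q : ℕ} (hQ : 0 < Q) :
    ∃ t : ℕ, 1 ≤ t ∧ t ≤ Q ^ k ∧ ∃ f : Fin k → ℤ, ∀ i, |t * w i - f i| ≤ 1 / Q := by
  have hQ' : (0 : ℝ) < Q := by exact_mod_cast hQ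
  let F : ℕ → Fin k → Fin Q := fun t i => ⟨⌊Int.fract (t * w i) * Q⌋₊, by
    rw [Nat.floor_lt (mul_nonneg (Int.fract_nonneg _) hQ'.le)]
    nlinarith [Int.fract_lt_one ((t : ℝ) * w i)]⟩
  have hcard : (Finset.univ : Finset (Fin k → Fin Q)).card < (Finset.range (Q ^ k + 1)).card := by
    simp
  obtain ⟨s, hs, t, ht, hst, hF⟩ := Finset.exists_ne_map_eq_of_card_lt_of_maps_to hcard
    (f := F) (fun _ _ => Finset.mem_coe.2 (Finset.mem_univ _))
  rw [Finset.mem_range] at hs ht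
  wlog hlt : s < t generalizing s t
  · exact this t ht s hs hst.symm hF.symm (by omega)
  refine ⟨t - s, by omega, by omega, fun i => ⌊t * w i⌋ - ⌊s * w i⌋, fun i => ?_⟩
  have h1 : ⌊Int.fract (s * w i) * Q⌋₊ = ⌊Int.fract (t * w i) * Q⌋₊ :=
    congrArg Fin.val (congrFun hF i)
  have a1 := Nat.floor_le (mul_nonneg (Int.fract_nonneg (s * w i)) hQ'.le)
  have a2 := Nat.lt_floor_add_one (Int.fract (s * w i) * Q)
  have a3 := Nat.floor_le (mul_nonneg (Int.fract_nonneg (t * w i)) hQ'.le)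
  have a4 := Nat.lt_floor_add_one (Int.fract (t * w i) * Q)
  rw [← h1] at a3 a4
  have e : ((t - s : ℕ) : ℝ) * w i - ((⌊t * w i⌋ - ⌊s * w i⌋ : ℤ) : ℝ)
      = Int.fract (t * w i) - Int.fract (s * w i) := by
    rw [Nat.cast_sub hlt.le, Int.fract, Int.fract]
    push_cast
    ring
  rw [e, abs_le, le_div_iff₀ hQ', ← neg_div, div_le_iff₀ hQ']
  constructor <;> nlinarith

/-- Suppose that `ℓ` is subadditive and positively homogeneous, and additive on a sum `x + y` unless
`ℓ x + ℓ y` exceeds `ℓ (x + y)` by at least `c`. Then `ℓ` is additive on `(h - f) + f` if `h` is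
close to a multiple `a f`: by convexity, the excess on `(h - (t + 1) f) + f` increases with `t`, and
the sum of these excesses for `t < a` is at most `ℓ r + ℓ (-r)`, where `r = h - a f`. -/
theorem eq_add_of_eq_nsmul_add {M : Type*} [AddCommGroup M] {ℓ : M → ℝ}
    (hadd : ∀ x y, ℓ (x + y) ≤ ℓ x + ℓ y) (hmul : ∀ (n : ℕ) x, ℓ (n • x) = n * ℓ x)
    {c : ℝ} (hgap : ∀ x y, ℓ (x + y) = ℓ x + ℓ y ∨ ℓ (x + y) + c ≤ ℓ x + ℓ y)
    {h f r : M} {a : ℕ} (hr : h = a • f + r) (hlt : ℓ r + ℓ (-r) < a * c) :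
    ℓ h = ℓ (h - f) + ℓ f := by
  let ψ : ℕ → ℝ := fun t => ℓ (h - t • f) + t * ℓ f
  have hconv : ∀ t, ψ (t + 1) - ψ t ≤ ψ (t + 2) - ψ (t + 1) := by
    intro t
    have h1 := hadd (h - t • f) (h - (t + 2) • f)
    have h2 : h - t • f + (h - (t + 2) • f) = 2 • (h - (t + 1) • f) := by
      simp only [add_smul, one_smul, two_smul]
      abel
    rw [h2, hmul] at h1
    simp only [ψ]
    push_cast at h1 ⊢
    linarith
  have hmono : ∀ t, ψ 1 - ψ 0 ≤ ψ (t + 1) - ψ t := by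
    intro t
    induction t with
    | zero => simp
    | succ t ih => exact ih.trans (hconv t)
  have hsum : ∀ t : ℕ, t * (ψ 1 - ψ 0) ≤ ψ t - ψ 0 := by
    intro t
    induction t with
    | zero => simp
    | succ t ih =>
      have := hmono t
      push_cast
      linarith
  have hψ0 : ψ 0 = ℓ h := by simp [ψ]
  have hψ1 : ψ 1 = ℓ (h - f) + ℓ f := by simp [ψ]
  have hψa : ψ a ≤ ψ 0 + (ℓ r + ℓ (-r)) := by
    have h1 := hadd h (-r)
    have h2 : h + -r = a • f := by rw [hr]; abel
    have h3 : h - a • f = r := by rw [hr]; abel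
    rw [h2, hmul] at h1
    simp only [ψ, h3, zero_smul, sub_zero]
    push_cast
    linarith
  have hlt' : a * (ψ 1 - ψ 0) < a * c := by
    have := hsum a
    linarith
  have hlt'' : ψ 1 - ψ 0 < c := lt_of_mul_lt_mul_left hlt' (Nat.cast_nonneg a)
  rw [hψ0, hψ1] at hlt''
  rcases hgap (h - f) f with h1 | h1
  · rwa [sub_add_cancel] at h1
  · rw [sub_add_cancel] at h1
    linarith

theorem exists_le_mul_norm {k : ℕ} {ℓ : (Fin k → ℤ) → ℝ} (hadd : ∀ x y, ℓ (x + y) ≤ ℓ x + ℓ y)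
    (hmul : ∀ (n : ℕ) x, ℓ (n • x) = n * ℓ x) : ∃ C : ℝ, 0 < C ∧ ∀ x, ℓ x ≤ C * ‖x‖ := by
  have h0 : ℓ 0 = 0 := by simpa using hmul 0 0
  let D : Fin k → ℝ := fun i => |ℓ (Pi.single i 1)| + |ℓ (-Pi.single i 1)|
  have hD : ∀ i, 0 ≤ D i := fun i => by positivity
  have hsingle : ∀ i (n : ℤ), ℓ (Pi.single i n) ≤ D i * ‖n‖ := by
    intro i n
    have hle : ∀ m : ℕ, m * ℓ (Pi.single i 1) ≤ D i * m ∧ m * ℓ (-Pi.single i 1) ≤ D i * m := by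
      intro m
      have h1 := le_abs_self (ℓ (Pi.single i 1))
      have h2 := le_abs_self (ℓ (-Pi.single i 1))
      have h3 := abs_nonneg (ℓ (Pi.single i 1))
      have h4 := abs_nonneg (ℓ (-Pi.single i 1))
      rw [mul_comm (D i)]
      exact ⟨mul_le_mul_of_nonneg_left (by simp only [D]; linarith) m.cast_nonneg,
        mul_le_mul_of_nonneg_left (by simp only [D]; linarith) m.cast_nonneg⟩
    obtain ⟨m, rfl | rfl⟩ := n.eq_nat_or_neg
    · have e : (Pi.single i (m : ℤ) : Fin k → ℤ) = m • Pi.single i 1 := by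
        rw [← Pi.single_smul]; simp
      rw [e, hmul]
      simpa using (hle m).1
    · have e : (Pi.single i (-(m : ℤ)) : Fin k → ℤ) = m • -Pi.single i 1 := by
        rw [← Pi.single_neg, ← Pi.single_smul]; simp
      rw [e, hmul]
      simpa using (hle m).2
  have hsum : ∀ (s : Finset (Fin k)) (g : Fin k → Fin k → ℤ),
      ℓ (∑ i ∈ s, g i) ≤ ∑ i ∈ s, ℓ (g i) := fun s g =>
    Finset.le_sum_of_subadditive ℓ h0.le hadd s g
  refine ⟨1 + ∑ i, D i, by positivity, fun x => ?_⟩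
  calc ℓ x = ℓ (∑ i, Pi.single i (x i)) := by rw [Finset.univ_sum_single]
    _ ≤ ∑ i, ℓ (Pi.single i (x i)) := hsum _ _
    _ ≤ ∑ i, D i * ‖x‖ := Finset.sum_le_sum fun i _ =>
        (hsingle i (x i)).trans (mul_le_mul_of_nonneg_left (norm_le_pi_norm x i) (hD i))
    _ = (∑ i, D i) * ‖x‖ := (Finset.sum_mul _ _ _).symm
    _ ≤ _ := mul_le_mul_of_nonneg_right (by linarith) (norm_nonneg x)

/-- Let `ℓ` be a subadditive and positively homogeneous function on `ℤᵏ` such that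
`ℓ x + ℓ y - ℓ (x + y)` is zero or at least `c > 0`. Then every vector outside a ball is the sum of
a shorter vector and of a vector in the ball, in such a way that `ℓ` is additive on the sum.
(So the unit ball of `ℓ` is a polytope.) -/
theorem exists_splitting {k : ℕ} {ℓ : (Fin k → ℤ) → ℝ}
    (hadd : ∀ x y, ℓ (x + y) ≤ ℓ x + ℓ y) (hmul : ∀ (n : ℕ) x, ℓ (n • x) = n * ℓ x)
    {c : ℝ} (hc : 0 < c) (hgap : ∀ x y, ℓ (x + y) = ℓ x + ℓ y ∨ ℓ (x + y) + c ≤ ℓ x + ℓ y) :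
    ∃ R : ℝ, ∀ h : Fin k → ℤ, R < ‖h‖ →
      ∃ f : Fin k → ℤ, ‖f‖ ≤ R ∧ ‖h - f‖ < ‖h‖ ∧ ℓ h = ℓ (h - f) + ℓ f := by
  obtain ⟨C, hC, hℓ⟩ := exists_le_mul_norm hadd hmul
  -- `r` will satisfy `‖r‖ ≤ 2 a / Q + T + 1`, and `2 * C * ‖r‖ < a * c` is needed
  obtain ⟨Q, hQ⟩ := exists_nat_gt (8 * C / c + 2)
  have hQ0 : (0 : ℝ) < Q := lt_trans (by positivity) hQ
  have hQ2 : (2 : ℝ) < Q := lt_of_le_of_lt (le_add_of_nonneg_left (by positivity)) hQ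
  have hQc : 8 * C < Q * c := by
    rw [← div_lt_iff₀ hc]
    linarith
  set T : ℝ := ((Q ^ k : ℕ) : ℝ) with hT
  have hT1 : 1 ≤ T := by
    rw [hT]
    exact_mod_cast Nat.one_le_pow _ _ (by exact_mod_cast hQ0)
  -- `B` bounds the multiples `a` that are needed to absorb the error term `T + 1`
  set B : ℝ := 4 * C * (T + 1) / c + 1 with hB
  have hB1 : 1 ≤ B := by rw [hB]; exact le_add_of_nonneg_left (by positivity)
  refine ⟨T * (B + 1) + 1, fun h hh => ?_⟩
  set m := ‖h‖ with hm
  have hm0 : 0 < m := lt_trans (by positivity) hh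
  obtain ⟨t, ht1, htT, f, hf⟩ := exists_int_vector_near_mul (fun i => (h i : ℝ) / m) (Q := Q)
    (by exact_mod_cast hQ0)
  have ht1' : (1 : ℝ) ≤ t := by exact_mod_cast ht1
  have htT' : (t : ℝ) ≤ T := by rw [hT]; exact_mod_cast htT
  have hQinv : 1 / (Q : ℝ) < 1 / 2 := one_div_lt_one_div_of_lt two_pos hQ2
  have hhi : ∀ i, |(h i : ℝ)| ≤ m := fun i => by
    have := norm_le_pi_norm h i
    rwa [Int.norm_eq_abs] at this
  have hfT : ∀ i, |(f i : ℝ)| ≤ T + 1 := by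
    intro i
    have h1 : |t * ((h i : ℝ) / m)| ≤ T := by
      rw [abs_mul, abs_div, abs_of_pos hm0, Nat.abs_cast]
      calc (t : ℝ) * (|(h i : ℝ)| / m) ≤ t * 1 :=
            mul_le_mul_of_nonneg_left ((div_le_one hm0).2 (hhi i)) (by positivity)
        _ ≤ T := by linarith
    have h2 := abs_sub_abs_le_abs_sub (f i : ℝ) (t * ((h i : ℝ) / m))
    rw [abs_sub_comm] at h2
    linarith [hf i]
  have ht0 : (0 : ℝ) < t := by linarith
  -- `t h / m` is close to `f`, so `h` is close to `a f`
  set a : ℕ := ⌊m / t⌋₊ with ha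
  have ha1 : (a : ℝ) ≤ m / t := Nat.floor_le (by positivity)
  have ha2 : m / t < a + 1 := Nat.lt_floor_add_one _
  have haB : B < a := by
    have : B + 1 ≤ m / t := by
      rw [le_div_iff₀ ht0]
      nlinarith
    linarith
  have ha0 : (0 : ℝ) < a := by linarith
  set r : Fin k → ℤ := h - a • f with hr
  have hrn : ‖r‖ ≤ 2 * a / Q + (T + 1) := by
    refine (pi_norm_le_iff_of_nonneg (by positivity)).2 fun i => ?_
    rw [Int.norm_eq_abs]
    have e : ((r i : ℤ) : ℝ) = (m / t) * (t * (h i / m) - f i) + (m / t - a) * f i := by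
      have e' : r i = h i - a * f i := by simp [hr]
      rw [e']
      push_cast
      field_simp
      ring
    have b1 : |(m / t) * (t * (h i / m) - f i)| ≤ 2 * a / Q := by
      rw [abs_mul, abs_of_pos (by positivity)]
      calc m / t * |t * ((h i : ℝ) / m) - f i| ≤ (2 * a) * (1 / Q) :=
            mul_le_mul (by linarith) (hf i) (abs_nonneg _) (by positivity)
        _ = _ := by ring
    have b2 : |(m / t - a) * f i| ≤ T + 1 := by
      rw [abs_mul, abs_of_nonneg (by linarith)]
      calc (m / t - a) * |(f i : ℝ)| ≤ 1 * (T + 1) :=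
            mul_le_mul (by linarith) (hfT i) (abs_nonneg _) zero_le_one
        _ = _ := one_mul _
    rw [e]
    exact (abs_add_le _ _).trans (add_le_add b1 b2)
  refine ⟨f, ?_, ?_, ?_⟩
  · refine (pi_norm_le_iff_of_nonneg (by positivity)).2 fun i => ?_
    rw [Int.norm_eq_abs]
    refine (hfT i).trans ?_
    nlinarith
  · refine (pi_norm_lt_iff hm0).2 fun i => ?_
    rw [Int.norm_eq_abs]
    have e : ((h - f) i : ℤ) = ((1 - t / m) * h i + (t * (h i / m) - f i) : ℝ) := by
      simp only [Pi.sub_apply]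
      push_cast
      field_simp
      ring
    have htm : (t : ℝ) / m ≤ 1 := by
      rw [div_le_one hm0]
      nlinarith
    rw [e]
    calc |(1 - t / m) * (h i : ℝ) + (t * (h i / m) - f i)|
        ≤ |(1 - t / m) * (h i : ℝ)| + |t * ((h i : ℝ) / m) - f i| := abs_add_le _ _
      _ ≤ (1 - t / m) * m + 1 / Q := by
          refine add_le_add ?_ (hf i)
          rw [abs_mul, abs_of_nonneg (by linarith)]
          exact mul_le_mul_of_nonneg_left (hhi i) (by linarith)
      _ = m - t + 1 / Q := by field_simp
      _ < m := by linarith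
  · refine eq_add_of_eq_nsmul_add hadd hmul hgap (r := r) (a := a) (by rw [hr]; abel) ?_
    have h1 := hℓ r
    have h2 := hℓ (-r)
    rw [norm_neg] at h2
    have h3 : C * ‖r‖ ≤ C * (2 * a / Q + (T + 1)) := mul_le_mul_of_nonneg_left hrn hC.le
    have h4 : C * (2 * a / Q) < a * c / 4 := by
      have : C * (2 * a / Q) = 8 * C * a / (4 * Q) := by field_simp; ring
      rw [this, div_lt_div_iff₀ (by positivity) (by positivity)]
      nlinarith
    have h5 : C * (T + 1) < a * c / 4 := by
      have h6 : 4 * C * (T + 1) / c < a := by linarith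
      rw [div_lt_iff₀ hc] at h6
      linarith
    linarith

end Lattice

/-! ### Flatness of finite extensions of finitely generated abelian groups -/

section FlatGroups

variable {Γ G : Type*} [Group Γ] [Group G] [MulDistribMulAction Γ G]
  [TopologicalSpace G] [IsTopologicalGroup G] [ContinuousConstSMul Γ G]

/-- An automorphism of finite order fixes its tidy subgroups `V`, since the powers of
`|a V : a V ∩ V|` are bounded by the indices `|aⁿ V : aⁿ V ∩ V|`. -/
theorem Tidy.smul_eq_of_pow_eq_one {a : Γ} {V : Subgroup G} (hV : V ∈ compactOpenSubgroups G)
    (h : Tidy a V) {n : ℕ} (hn : n ≠ 0) (ha : a ^ n = 1) : a • V = V := by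
  have key : ∀ b : Γ, Tidy b V → b ^ n = 1 → b • V ≤ V := by
    intro b hb hbn
    have h1 := hb.pow_relIndex_le n
    rw [hbn, one_smul, Subgroup.relIndex_self] at h1
    have h2 : V.relIndex (b • V) ≤ 1 := by
      by_contra! h3
      exact absurd (one_lt_pow₀ h3 hn) (not_lt.2 h1)
    exact Subgroup.relIndex_eq_one.1 (le_antisymm h2 (Nat.one_le_iff_ne_zero.2
      (relIndex_ne_zero hV (smul_mem_compactOpenSubgroups b hV))))
  refine le_antisymm (key a h ha) ?_
  rw [Subgroup.subset_pointwise_smul_iff]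
  exact key a⁻¹ h.inv (by rw [inv_pow, ha, inv_one])

/-- If `Γ` is a finite extension of a finitely generated abelian group, then some compact open
subgroup attains the scale of every element of `Γ`. -/
theorem exists_forall_relIndex_eq_scale [T2Space G] (hne : (compactOpenSubgroups G).Nonempty)
    {Φ : Subgroup Γ} [Finite Φ] [Φ.Normal] [Group.FG (Γ ⧸ Φ)]
    (hΦ : ∀ x y : Γ ⧸ Φ, x * y = y * x) :
    ∃ V ∈ compactOpenSubgroups G, ∀ g : Γ, V.relIndex (g • V) = scale G g := by
  classical
  have hcomm : ∀ g h : Γ, (h * g)⁻¹ * (g * h) ∈ Φ := fun g h =>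
    QuotientGroup.eq.1 (hΦ (h : Γ ⧸ Φ) (g : Γ ⧸ Φ))
  -- adding the elements of `Φ` to `S` makes `V` invariant under `Φ`
  have htidy : ∀ S : Finset Γ, ∃ V ∈ compactOpenSubgroups G, CommutingTranslates Γ V ∧
      (∀ g h : Γ, (g : Γ ⧸ Φ) = h → g • V = h • V) ∧ ∀ a ∈ S, Tidy a V := by
    intro S
    obtain ⟨V, hV, hVc, hVt⟩ := exists_common_tidy hne hcomm
      (S ∪ (Set.toFinite (Φ : Set Γ)).toFinset)
    refine ⟨V, hV, hVc, fun g h hgh => ?_, fun a ha => hVt a (Finset.mem_union_left _ ha)⟩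
    have hφ := QuotientGroup.eq.1 hgh
    have h1 := hVt (g⁻¹ * h) (Finset.mem_union_right _ (by simpa using hφ))
    have h2 : (g⁻¹ * h) ^ Nat.card Φ = 1 := by
      have := pow_card_eq_one' (x := (⟨_, hφ⟩ : Φ))
      exact congrArg Subtype.val this
    have h3 := h1.smul_eq_of_pow_eq_one hV Nat.card_pos.ne' h2
    rw [mul_smul, inv_smul_eq_iff] at h3
    exact h3.symm
  have hscale : ∀ g h : Γ, (g : Γ ⧸ Φ) = h → scale G g = scale G h := by
    intro g h hgh
    obtain ⟨V, hV, -, hVΦ, hVt⟩ := htidy {g, h}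
    rw [← (hVt g (by simp)).relIndex_eq_scale hV, ← (hVt h (by simp)).relIndex_eq_scale hV,
      hVΦ g h hgh]
  have hdvd : ∀ g h : Γ, scale G (g * h) ∣ scale G g * scale G h := by
    intro g h
    obtain ⟨V, hV, hVc, -, hVt⟩ := htidy {g, h, g * h}
    exact scale_mul_dvd hV hVc (hVt g (by simp)) (hVt h (by simp)) (hVt _ (by simp))
  have hpow : ∀ (g : Γ) (n : ℕ), scale G (g ^ n) = scale G g ^ n := by
    intro g n
    obtain ⟨V, hV, -, -, hVt⟩ := htidy {g}
    have hg := hVt g (by simp)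
    refine le_antisymm ?_ (hg.scale_pow_le hV n)
    rw [← hg.relIndex_eq_scale hV]
    exact (scale_le _ hV).trans (relIndex_pow_smul_le g hV n)
  let _ : CommGroup (Γ ⧸ Φ) := { (inferInstance : Group (Γ ⧸ Φ)) with mul_comm := hΦ }
  have : Module.Finite ℤ (Additive (Γ ⧸ Φ)) :=
    Module.Finite.iff_addGroup_fg.2 (GroupFG.iff_add_fg.1 inferInstance)
  obtain ⟨k, π, hπ⟩ := Module.Finite.exists_fin' ℤ (Additive (Γ ⧸ Φ))
  -- a section of `Γ → Γ ⧸ Φ`, composed with the surjection `π`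
  let t : (Fin k → ℤ) → Γ := fun z => (π z).toMul.out
  have ht : ∀ z, (t z : Γ ⧸ Φ) = (π z).toMul := fun z => QuotientGroup.out_eq' _
  have htadd : ∀ x y, ((t (x + y) : Γ) : Γ ⧸ Φ) = (t x * t y : Γ) := fun x y => by
    rw [QuotientGroup.mk_mul, ht, ht, ht, map_add, toMul_add]
  have htmul : ∀ (n : ℕ) x, ((t (n • x) : Γ) : Γ ⧸ Φ) = (t x ^ n : Γ) := fun n x => by
    rw [QuotientGroup.mk_pow, ht, ht, map_nsmul, toMul_nsmul]
  let ℓ : (Fin k → ℤ) → ℝ := fun z => Real.log (scale G (t z))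
  have hpos : ∀ g : Γ, (0 : ℝ) < scale G g := fun g => by exact_mod_cast scale_pos hne g
  have hℓadd : ∀ x y, ∃ q : ℕ, q ≠ 0 ∧ ℓ x + ℓ y = ℓ (x + y) + Real.log q := by
    intro x y
    obtain ⟨q, hq⟩ := hdvd (t x) (t y)
    have hq0 : q ≠ 0 := by
      rintro rfl
      exact (Nat.mul_pos (scale_pos hne (t x)) (scale_pos hne (t y))).ne' (by simpa using hq)
    refine ⟨q, hq0, ?_⟩
    simp only [ℓ]
    rw [hscale _ _ (htadd x y), ← Real.log_mul (hpos _).ne' (hpos _).ne',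
      ← Real.log_mul (hpos _).ne' (by exact_mod_cast hq0)]
    exact_mod_cast congrArg (fun n : ℕ => Real.log n) hq
  have hℓmul : ∀ (n : ℕ) x, ℓ (n • x) = n * ℓ x := by
    intro n x
    simp only [ℓ]
    rw [hscale _ _ (htmul n x), hpow, Nat.cast_pow, Real.log_pow]
  obtain ⟨R, hR⟩ := exists_splitting (ℓ := ℓ) (c := Real.log 2)
    (fun x y => by
      obtain ⟨q, -, h⟩ := hℓadd x y
      rw [h]
      exact le_add_of_nonneg_right (Real.log_natCast_nonneg q))
    hℓmul (Real.log_pos one_lt_two) (fun x y => by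
      obtain ⟨q, hq, h⟩ := hℓadd x y
      rw [h]
      rcases Nat.lt_or_ge q 2 with hq2 | hq2
      · obtain rfl : q = 1 := by omega
        exact Or.inl (by simp)
      · exact Or.inr (by
          gcongr
          exact_mod_cast hq2))
  have hfin : ∀ r : ℝ, {z : Fin k → ℤ | ‖z‖ ≤ r}.Finite := by
    intro r
    refine (Set.finite_Icc (fun _ => -⌊r⌋) (fun _ => ⌊r⌋)).subset fun z hz => ?_
    have h1 : ∀ i, |z i| ≤ ⌊r⌋ := fun i => by
      rw [Int.le_floor]
      have := (norm_le_pi_norm z i).trans hz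
      rwa [Int.norm_eq_abs, ← Int.cast_abs] at this
    exact ⟨fun i => (abs_le.1 (h1 i)).1, fun i => (abs_le.1 (h1 i)).2⟩
  obtain ⟨V, hV, -, hVΦ, hVt⟩ := htidy ((hfin R).toFinset.image t)
  have hsmall : ∀ z, ‖z‖ ≤ R → V.relIndex (t z • V) = scale G (t z) := fun z hz =>
    (hVt _ (Finset.mem_image_of_mem t (by simpa using hz))).relIndex_eq_scale hV
  -- a shortest counterexample would split into two vectors where the scale is attained
  have hall : ∀ z, V.relIndex (t z • V) = scale G (t z) := by
    by_contra! hbad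
    obtain ⟨z₀, hz₀⟩ := hbad
    obtain ⟨z, ⟨hz, hzz₀⟩, hmin⟩ := Set.exists_min_image
      ({z | V.relIndex (t z • V) ≠ scale G (t z)} ∩ {z | ‖z‖ ≤ ‖z₀‖}) (fun z => ‖z‖)
      ((hfin _).inter_of_right _) ⟨z₀, hz₀, le_refl ‖z₀‖⟩
    have hzR : R < ‖z‖ := by
      by_contra! h
      exact hz (hsmall z h)
    obtain ⟨f, hfR, hlt, hsplit⟩ := hR z hzR
    have hzf : V.relIndex (t (z - f) • V) = scale G (t (z - f)) := by
      by_contra h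
      exact absurd (hmin _ ⟨h, hlt.le.trans hzz₀⟩) (not_le.2 hlt)
    refine hz (le_antisymm ?_ (scale_le _ hV))
    have h1 : (scale G (t z) : ℝ) = scale G (t (z - f)) * scale G (t f) := by
      refine Real.log_injOn_pos (hpos _) (mul_pos (hpos _) (hpos _)) ?_
      rw [Real.log_mul (hpos _).ne' (hpos _).ne']
      exact hsplit
    have h2 : scale G (t z) = scale G (t (z - f)) * scale G (t f) := by exact_mod_cast h1
    have h3 := htadd (z - f) f
    rw [sub_add_cancel] at h3
    rw [hVΦ _ _ h3, h2, ← hzf, ← hsmall f hfR]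
    exact relIndex_mul_smul_le hV _ _
  refine ⟨V, hV, fun g => ?_⟩
  obtain ⟨z, hz⟩ := hπ (Additive.ofMul (g : Γ ⧸ Φ))
  have hgz : (g : Γ ⧸ Φ) = t z := by rw [ht, hz, toMul_ofMul]
  rw [hVΦ _ _ hgz, hscale _ _ hgz, hall]

/-- The case of the action by conjugation through a homomorphism into `G`. -/
theorem exists_forall_relIndex_conj_le {Γ G : Type*} [Group Γ] [Group G] [TopologicalSpace G]
    [IsTopologicalGroup G] [LocallyCompactSpace G] [TotallyDisconnectedSpace G]
    (ρ : Γ →* G) {Φ : Subgroup Γ} [Finite Φ] [Φ.Normal] [Group.FG (Γ ⧸ Φ)]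
    (hΦ : ∀ x y : Γ ⧸ Φ, x * y = y * x) :
    ∃ V ∈ compactOpenSubgroups G, ∀ g : Γ, ∀ W ∈ compactOpenSubgroups G,
      V.relIndex (MulAut.conj (ρ g) • V) ≤ W.relIndex (MulAut.conj (ρ g) • W) := by
  let _ : MulDistribMulAction Γ G := MulDistribMulAction.compHom G (MulAut.conj.comp ρ)
  have hsmul : ∀ (g : Γ) (x : G), g • x = ρ g * x * (ρ g)⁻¹ := fun g x => rfl
  have : ContinuousConstSMul Γ G := ⟨fun g => by
    simp only [hsmul]
    fun_prop⟩
  obtain ⟨V, hV, hVs⟩ := exists_forall_relIndex_eq_scale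
    (compactOpenSubgroups_nonempty (G := G)) hΦ
  exact ⟨V, hV, fun g W hW => (hVs g).trans_le (scale_le g hW)⟩

end FlatGroups

end TDLC

theorem mainTheorem7 {G : Type*} [Group G] [TopologicalSpace G] [IsTopologicalGroup G]
    [LocallyCompactSpace G] [TotallyDisconnectedSpace G]
    (A : Subgroup G) (hA : TDLC.IsFiniteExtensionOfFGAbelian A) :
    TDLC.IsFlat A := by
  obtain ⟨N, hN, hNfin, hfg, hcomm⟩ := hA
  obtain ⟨V, hV, hmin⟩ := TDLC.exists_forall_relIndex_conj_le A.subtype hcomm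
  have hdisp : ∀ (h : G) (W : Subgroup G), TDLC.displacement (TDLC.innerAut h) W =
      Real.log ((W.relIndex (MulAut.conj h • W) : ℝ) *
        (W.relIndex (MulAut.conj h⁻¹ • W) : ℝ)) := fun h W => by
    have himage : TDLC.autImage (TDLC.innerAut h) W = MulAut.conj h • W := rfl
    rw [TDLC.displacement, TDLC.subgroupDist, himage, Subgroup.inf_relIndex_left,
      Subgroup.inf_relIndex_left, ← Subgroup.relIndex_pointwise_smul (MulAut.conj h)⁻¹ _ W,
      inv_smul_smul, map_inv]
  refine ⟨V, hV, fun h hh => ⟨hV, fun W hW => ?_⟩⟩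
  change TDLC.displacement _ V ≤ TDLC.displacement _ W
  rw [hdisp, hdisp]
  have hpos : ∀ g : G, (0 : ℝ) < V.relIndex (MulAut.conj g • V) := fun g => by
    have : IsCompact ((MulAut.conj g • V : Subgroup G) : Set G) :=
      hV.1.image (TDLC.innerAut g).continuous
    exact_mod_cast Nat.pos_of_ne_zero (TDLC.relIndex_ne_zero_of_isCompact hV.2 this)
  refine Real.log_le_log (mul_pos (hpos _) (hpos _))
    (mul_le_mul ?_ ?_ (hpos _).le (Nat.cast_nonneg _))
  · exact_mod_cast hmin ⟨h, hh⟩ W hW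
  · exact_mod_cast hmin ⟨h, hh⟩⁻¹ W hW
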